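/- Identify operators on $\mathbb{C}^2\otimes\mathbb{C}^2$ with matrices in the basis $|00\rangle,|01\rangle,|10\rangle,|11\rangle$, and let $X,Y,Z$ be the Pauli matrices. A density operator is a positive semidefinite operator of trace $1$. A qubit observable is an operator $\vec a\cdot\vec\sigma=a_1X+a_2Y+a_3Z$ with $\vec a\in\mathbb{R}^3$ a unit vector, and a CHSH operator is an operator $S=A\otimes(B+B')+A'\otimes(B-B')$ with qubit observables $A,A',B,B'$. The nonlocality of a two-qubit density operator $\rho$ is $\mathcal N(\rho)=\max_S \operatorname{tr}(\rho S)$, the maximum over all CHSH operators. The concurrence of $\rho$ is $C(\rho)=\max\{0,\lambda_1-\lambda_2-\lambda_3-\lambda_4\}$, where $\lambda_1\ge\lambda_2\ge\lambda_3\ge\lambda_4$ are the eigenvalues of $\sqrt{\sqrt\rho\,\tilde\rho\sqrt\rho}$, $\tilde\rho=(Y\otimes Y)\rho^*(Y\otimes Y)$, and $\rho^*$ is the entrywise complex conjugate of $\rho$. Let $\mathcal Q$ be the set of all operators $$(U_A\otimes U_B)\bigl(p|\varphi_1\rangle\langle\varphi_1|+(1-p)|\varphi_2\rangle\langle\varphi_2|\bigr)(U_A\otimes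 U_B)^\dagger,$$ where $U_A,U_B$ are unitaries on $\mathbb{C}^2$, $p\in[0,1]$, and $|\varphi_1\rangle=\cos\theta|00\rangle+\sin\theta|11\rangle$, $|\varphi_2\rangle=\sin\theta|00\rangle+\cos\theta|11\rangle$ for some $\theta\in[0,\pi)$. **Theorem.** Let $\rho$ be any two-qubit density operator and $C=C(\rho)$. Then the maximum defining $\mathcal N(\rho)$ is attained, and $$\mathcal N(\rho)\le 2\sqrt{1+C^2},$$ with equality if and only if $\rho\in\mathcal Q$. Moreover, $\mathcal Q$ is exactly the set of all operators $(U_A\otimes U_B)\,\omega\,(U_A\otimes U_B)^\dagger$, where $U_A,U_B$ are unitaries on $\mathbb{C}^2$ and $\omega$ is a Verstraete–Wolf state, that is, a density operator of the form $$\omega=\frac12\begin{pmatrix}0&0&0&0\\0&1-\alpha&c&0\\0&c&1+\alpha&0\\0&0&0&0\end{pmatrix},\qquad \alpha,c\in\mathbb{R},\quad c=C(\omega).$$ -/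

import Mathlib

open scoped Kronecker MatrixOrder ComplexOrder

noncomputable section

namespace TwoQubit

/-- Operators on the one-qubit space, in the computational basis `|0⟩, |1⟩`. -/
abbrev QubitOp : Type := Matrix (Fin 2) (Fin 2) ℂ

/-- Operators on the two-qubit space; the index `(i, j)` stands for the basis vector `|ij⟩`. -/
abbrev Op : Type := Matrix (Fin 2 × Fin 2) (Fin 2 × Fin 2) ℂ

/-- A density operator: positive semidefinite with trace one. -/
def IsDensity (ρ : Op) : Prop := ρ.PosSemidef ∧ ρ.trace = 1

def pauliX : QubitOp := !![0, 1; 1, 0]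

def pauliY : QubitOp := !![0, -Complex.I; Complex.I, 0]

def pauliZ : QubitOp := !![1, 0; 0, -1]

/-- The operator `a · σ` for a real three-dimensional vector `a`. -/
def pauliDot (a : EuclideanSpace ℝ (Fin 3)) : QubitOp :=
  (a 0 : ℂ) • pauliX + (a 1 : ℂ) • pauliY + (a 2 : ℂ) • pauliZ

/-- A qubit measurement observable: `a · σ` for a unit vector `a`. -/
def IsObservable (A : QubitOp) : Prop :=
  ∃ a : EuclideanSpace ℝ (Fin 3), ‖a‖ = 1 ∧ A = pauliDot a

/-- A CHSH operator `A ⊗ (B + B') + A' ⊗ (B - B')`. -/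
def IsCHSHOperator (S : Op) : Prop :=
  ∃ A A' B B' : QubitOp, IsObservable A ∧ IsObservable A' ∧ IsObservable B ∧ IsObservable B' ∧
    S = A ⊗ₖ (B + B') + A' ⊗ₖ (B - B')

/-- The set of values `tr (ρ S)`, over all CHSH operators `S`. -/
def chshValues (ρ : Op) : Set ℝ := {x | ∃ S : Op, IsCHSHOperator S ∧ x = (ρ * S).trace.re}

/-- The nonlocality of `ρ`: the maximal CHSH value. -/
def nonlocality (ρ : Op) : ℝ := sSup (chshValues ρ)

/-- The spin flip `(Y ⊗ Y) ρ* (Y ⊗ Y)`, where `ρ*` is the entrywise complex conjugate. -/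
def spinFlip (ρ : Op) : Op := (pauliY ⊗ₖ pauliY) * ρ.map star * (pauliY ⊗ₖ pauliY)

/-- The matrix `√(√ρ ρ̃ √ρ)`, where `ρ̃` is the spin flip of `ρ`. -/
def concurrenceMatrix (ρ : Op) : Op :=
  CFC.sqrt (CFC.sqrt ρ * spinFlip ρ * CFC.sqrt ρ)

theorem concurrenceMatrix_isHermitian (ρ : Op) : (concurrenceMatrix ρ).IsHermitian :=
  (Matrix.nonneg_iff_posSemidef.mp (CFC.sqrt_nonneg _)).isHermitian

/-- The eigenvalues of `√(√ρ ρ̃ √ρ)`, with multiplicity, in nonincreasing order. -/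
def concurrenceEigenvalue (ρ : Op) (k : Fin 4) : ℝ :=
  (concurrenceMatrix_isHermitian ρ).eigenvalues₀ (Fin.cast (by simp) k)

/-- The concurrence `max {0, λ₁ - λ₂ - λ₃ - λ₄}`. -/
def concurrence (ρ : Op) : ℝ :=
  max 0 (concurrenceEigenvalue ρ 0 - concurrenceEigenvalue ρ 1 - concurrenceEigenvalue ρ 2
    - concurrenceEigenvalue ρ 3)

/-- The basis vector `|ij⟩`. -/
def ket (i j : Fin 2) : Fin 2 × Fin 2 → ℂ := Pi.single (i, j) 1

/-- The operator `|v⟩⟨v|`. -/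
def ketbra (v : Fin 2 × Fin 2 → ℂ) : Op := Matrix.vecMulVec v (star v)

/-- `cos θ |00⟩ + sin θ |11⟩` -/
def phi₁ (θ : ℝ) : Fin 2 × Fin 2 → ℂ :=
  (Real.cos θ : ℂ) • ket 0 0 + (Real.sin θ : ℂ) • ket 1 1

/-- `sin θ |00⟩ + cos θ |11⟩` -/
def phi₂ (θ : ℝ) : Fin 2 × Fin 2 → ℂ :=
  (Real.sin θ : ℂ) • ket 0 0 + (Real.cos θ : ℂ) • ket 1 1

/-- `p |φ₁⟩⟨φ₁| + (1 - p) |φ₂⟩⟨φ₂|` -/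
def phiMixture (p θ : ℝ) : Op :=
  (p : ℂ) • ketbra (phi₁ θ) + ((1 - p : ℝ) : ℂ) • ketbra (phi₂ θ)

/-- `(U ⊗ V) ρ (U ⊗ V)†` -/
def localConj (U V : Matrix.unitaryGroup (Fin 2) ℂ) (ρ : Op) : Op :=
  ((U : QubitOp) ⊗ₖ (V : QubitOp)) * ρ * ((U : QubitOp) ⊗ₖ (V : QubitOp)).conjTranspose

/-- The set `𝒬` of all operators that are, up to local unitaries, one of the mixtures above. -/
def Q : Set Op :=
  {ρ | ∃ (U V : Matrix.unitaryGroup (Fin 2) ℂ) (p θ : ℝ),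
    p ∈ Set.Icc (0 : ℝ) 1 ∧ θ ∈ Set.Ico (0 : ℝ) Real.pi ∧ ρ = localConj U V (phiMixture p θ)}

/-- The Verstraete-Wolf matrix; rows and columns are in the order `|00⟩, |01⟩, |10⟩, |11⟩`. -/
def vwMatrix (α c : ℝ) : Op :=
  ((1 / 2 : ℂ) • (!![0, 0, 0, 0;
      0, 1 - (α : ℂ), (c : ℂ), 0;
      0, (c : ℂ), 1 + (α : ℂ), 0;
      0, 0, 0, 0] : Matrix (Fin 4) (Fin 4) ℂ)).submatrix finProdFinEquiv finProdFinEquiv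

/-- The operators that are, up to local unitaries, a Verstraete-Wolf state: a density operator
`vwMatrix α c` whose concurrence is the parameter `c`. -/
def vwClass : Set Op :=
  {ρ | ∃ (U V : Matrix.unitaryGroup (Fin 2) ℂ) (α c : ℝ),
    IsDensity (vwMatrix α c) ∧ concurrence (vwMatrix α c) = c ∧
      ρ = localConj U V (vwMatrix α c)}

end TwoQubit

end

/-!
The bound rests on two normal forms.

*CHSH operators.* A CHSH operator is `∑ Kᵢⱼ σᵢ ⊗ σⱼ` with `K = a (b + b')ᵀ + a' (b - b')ᵀ`, a real
matrix of rank at most two and Hilbert–Schmidt norm `2`. By its singular value decomposition and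
because rotations of the Bloch sphere are unitary conjugations, the operator is, up to local
unitaries, `2 c Z ⊗ Z + 2 s X ⊗ X` with `c ≥ s ≥ 0` and `c² + s² = 1`
(`IsCHSHOperator.exists_normalForm`).

*States.* Write `ρ = W W†`. The numbers `λₖ` in the concurrence are the singular values of the
complex symmetric matrix `Wᵀ (Y ⊗ Y) W`, because their squares are the eigenvalues of `ρ ρ̃`. Takagi
factorization (`exists_takagi`), a choice of phases and a Hadamard matrix give a decomposition
`ρ = ∑ |z⟩⟨z|` for which `∑ |zᵀ (Y ⊗ Y) z|` is the concurrence (`exists_decomposition`). For a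
single vector, `|zᵀ (Y ⊗ Y) z|` bounds the expectation of `2 |Φ⟩⟨Φ| - 1`, where
`Φ = (|00⟩ + |11⟩) / √2`, so this expectation is at most `C(ρ)` for every state
(`fidelity_le_concurrence`).

Let `m` be the weight of `ρ` outside the span of `|00⟩` and `|11⟩`. Then
`tr ρ (2 c Z ⊗ Z + 2 s X ⊗ X) ≤ 2 c + 2 s tr ρ (2 |Φ⟩⟨Φ| - 1) - 4 (c - s) m`, which is at most
`2 (c + s C) ≤ 2 √(1 + C²)`, the last step being the Cauchy–Schwarz inequality. Equality forces
`m = 0`: this is clear if `c > s`, while `c = s` forces `C = 1` and hence `ρ = |Φ⟩⟨Φ|`. A state on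
the span of `|00⟩` and `|11⟩` belongs to `Q` once its off-diagonal entry is made real by a diagonal
unitary. Conversely, on such a state `Z ⊗ Z` and `X ⊗ X` have expectations `1` and `± C`, so the
coefficients proportional to these expectations attain the bound. Flipping one of the qubits turns
these states into the Verstraete–Wolf states.
-/

namespace TwoQubit

/-! ### Takagi factorization -/

section Takagi

open InnerProductSpace

variable {E : Type*} [NormedAddCommGroup E] [InnerProductSpace ℂ E] [FiniteDimensional ℂ E]

/-- A symmetric antilinear map has, in each nonzero invariant subspace, a unit vector which it
scales by a nonnegative real factor. The square of the map is linear, symmetric and positive; if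
`x` is an eigenvector of the square for `μ ^ 2`, then `T x + μ x` is scaled by `μ`, and if this
vector vanishes then `i x` is scaled by `μ`. -/
theorem exists_unit_antilinear_eigenvector (T : E →ₛₗ[starRingEnd ℂ] E)
    (hT : ∀ x y, inner ℂ x (T y) = inner ℂ y (T x)) (K : Submodule ℂ E)
    (hK : ∀ x ∈ K, T x ∈ K) (hK0 : K ≠ ⊥) :
    ∃ x ∈ K, ‖x‖ = 1 ∧ ∃ μ : ℝ, 0 ≤ μ ∧ T x = (μ : ℂ) • x := by
  have main : ∃ x ∈ K, x ≠ 0 ∧ ∃ μ : ℝ, 0 ≤ μ ∧ T x = (μ : ℂ) • x := by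
    let L : E →ₗ[ℂ] E := T.comp T
    have hLK : ∀ x ∈ K, L x ∈ K := fun x hx => hK _ (hK x hx)
    have hsym : (L.restrict hLK).IsSymmetric := by
      intro x y
      change inner ℂ (T (T x)) (y : E) = inner ℂ (x : E) (T (T y))
      rw [hT, ← inner_conj_symm, hT, inner_conj_symm]
    have : Nontrivial K := Submodule.nontrivial_iff_ne_bot.mpr hK0
    obtain ⟨a, ha⟩ : ∃ a, Module.End.HasEigenvalue (L.restrict hLK) a := by
      by_contra! h
      refine not_subsingleton K (hsym.subsingleton_of_no_eigenvalue_finiteDimensional fun μ => ?_)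
      exact not_not.mp (h μ)
    obtain ⟨x, hx⟩ := ha.exists_hasEigenvector
    have hx0 : (x : E) ≠ 0 := fun h => hx.2 (Subtype.ext h)
    have hTT : T (T x) = a • (x : E) := congrArg Subtype.val hx.apply_eq_smul
    have hnorm : a * (‖(x : E)‖ ^ 2 : ℝ) = (‖T x‖ ^ 2 : ℝ) := by
      have h := hT (x : E) (T x)
      rw [hTT, inner_smul_right, inner_self_eq_norm_sq_to_K, inner_self_eq_norm_sq_to_K] at h
      push_cast
      exact h
    have hxpos : 0 < ‖(x : E)‖ := norm_pos_iff.mpr hx0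
    set μ : ℝ := ‖T x‖ / ‖(x : E)‖ with hμ
    have hμ0 : 0 ≤ μ := by positivity
    have haμ : a = (μ : ℂ) * μ := by
      have hne : ((‖(x : E)‖ : ℝ) : ℂ) ≠ 0 := by exact_mod_cast hxpos.ne'
      rw [hμ]
      push_cast at hnorm ⊢
      field_simp
      linear_combination hnorm
    by_cases hy : T x + (μ : ℂ) • (x : E) = 0
    · refine ⟨Complex.I • (x : E), K.smul_mem _ x.2, smul_ne_zero Complex.I_ne_zero hx0, μ, hμ0, ?_⟩
      rw [map_smulₛₗ, eq_neg_of_add_eq_zero_left hy, Complex.conj_I, smul_neg, neg_smul, neg_neg,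
        smul_comm]
    · refine ⟨_, K.add_mem (hK x x.2) (K.smul_mem (μ : ℂ) x.2), hy, μ, hμ0, ?_⟩
      rw [map_add, map_smulₛₗ, hTT, Complex.conj_ofReal, smul_add, smul_smul, haμ, add_comm]
  obtain ⟨x, hxK, hx0, μ, hμ, hx⟩ := main
  refine ⟨((‖x‖⁻¹ : ℝ) : ℂ) • x, K.smul_mem _ hxK, ?_, μ, hμ, ?_⟩
  · rw [norm_smul, Complex.norm_real, norm_inv, norm_norm,
      inv_mul_cancel₀ (norm_ne_zero_iff.mpr hx0)]
  · rw [map_smulₛₗ, Complex.conj_ofReal, hx, smul_comm]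

/-- A symmetric antilinear map has an orthonormal family of eigenvectors with nonnegative factors,
of any size up to the dimension: the orthogonal complement of such a family is invariant. -/
theorem exists_orthonormal_antilinear_eigenvectors (T : E →ₛₗ[starRingEnd ℂ] E)
    (hT : ∀ x y, inner ℂ x (T y) = inner ℂ y (T x)) (k : ℕ) (hk : k ≤ Module.finrank ℂ E) :
    ∃ (v : Fin k → E) (d : Fin k → ℝ), Orthonormal ℂ v ∧ (∀ i, 0 ≤ d i) ∧
      ∀ i, T (v i) = (d i : ℂ) • v i := by
  induction k with
  | zero => exact ⟨Fin.elim0, Fin.elim0, ⟨fun i => i.elim0, fun i => i.elim0⟩, fun i => i.elim0,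
      fun i => i.elim0⟩
  | succ k ih =>
    obtain ⟨v, d, hv, hd, hTv⟩ := ih (by omega)
    let K : Submodule ℂ E := (Submodule.span ℂ (Set.range v))ᗮ
    have hmem : ∀ x, x ∈ K ↔ ∀ i, inner ℂ (v i) x = 0 := by
      intro x
      constructor
      · intro h i
        exact h _ (Submodule.subset_span ⟨i, rfl⟩)
      · intro h
        rw [Submodule.mem_orthogonal]
        intro u hu
        induction hu using Submodule.span_induction with
        | mem u hu => obtain ⟨i, rfl⟩ := hu; exact h i
        | zero => simp
        | add a b _ _ ha hb => rw [inner_add_left, ha, hb, add_zero]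
        | smul c a _ ha => rw [inner_smul_left, ha, mul_zero]
    have hK : ∀ x ∈ K, T x ∈ K := by
      intro x hx
      rw [hmem] at hx ⊢
      intro i
      rw [hT, hTv, inner_smul_right, ← inner_conj_symm, hx i, map_zero, mul_zero]
    have hK0 : K ≠ ⊥ := by
      intro h
      have h1 := Submodule.finrank_add_finrank_orthogonal (Submodule.span ℂ (Set.range v))
      have h2 : Module.finrank ℂ K = 0 := by rw [h]; exact finrank_bot ℂ E
      have h3 := finrank_range_le_card (R := ℂ) v
      rw [Set.finrank, Fintype.card_fin] at h3
      change _ + Module.finrank ℂ K = _ at h1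
      omega
    obtain ⟨x, hxK, hx1, μ, hμ, hx⟩ := exists_unit_antilinear_eigenvector T hT K hK hK0
    refine ⟨Matrix.vecCons x v, Matrix.vecCons μ d, ?_, ?_, ?_⟩
    · rw [orthonormal_vecCons_iff]
      refine ⟨hx1, fun i => ?_, hv⟩
      rw [← inner_conj_symm, (hmem x).mp hxK i, map_zero]
    · exact Fin.cases hμ hd
    · exact Fin.cases hx hTv

end Takagi

open Matrix in
/-- **Takagi factorization**, with the singular values in nonincreasing order. -/
theorem exists_takagi {n : Type*} [Fintype n] [DecidableEq n] {m : ℕ} (hm : Fintype.card n = m)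
    (τ : Matrix n n ℂ) (hτ : τᵀ = τ) :
    ∃ (V : Matrix n (Fin m) ℂ) (d : Fin m → ℝ), Vᴴ * V = 1 ∧ V * Vᴴ = 1 ∧ (∀ i, 0 ≤ d i) ∧
      Antitone d ∧ Vᵀ * τ * V = diagonal fun i => (d i : ℂ) := by
  -- the columns of `V` are eigenvectors of the antilinear map `x ↦ star (τ x)`
  let T : EuclideanSpace ℂ n →ₛₗ[starRingEnd ℂ] EuclideanSpace ℂ n :=
    { toFun := fun x => WithLp.toLp 2 (star (τ *ᵥ x.ofLp))
      map_add' := fun x y => by simp [mulVec_add]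
      map_smul' := fun c x => by simp [mulVec_smul] }
  have hTx : ∀ x, (T x).ofLp = star (τ *ᵥ x.ofLp) := fun x => rfl
  have hT : ∀ x y, inner ℂ x (T y) = inner ℂ y (T x) := by
    intro x y
    rw [EuclideanSpace.inner_eq_star_dotProduct, EuclideanSpace.inner_eq_star_dotProduct, hTx, hTx,
      star_dotProduct_star, star_dotProduct_star, dotProduct_mulVec, ← mulVec_transpose, hτ,
      dotProduct_comm]
  obtain ⟨v, d, hv, hd, hTv⟩ := exists_orthonormal_antilinear_eigenvectors T hT m (by simp [hm])
  let σ : Equiv.Perm (Fin m) := Tuple.sort (fun i => - d i)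
  have hσ : Antitone (d ∘ σ) := fun i j hij =>
    neg_le_neg_iff.mp (Tuple.monotone_sort (fun i => - d i) hij)
  let V : Matrix n (Fin m) ℂ := Matrix.of fun a i => v (σ i) a
  have hV : Vᴴ * V = 1 := by
    ext i j
    have h := (orthonormal_iff_ite.mp hv) (σ i) (σ j)
    rw [EuclideanSpace.inner_eq_star_dotProduct] at h
    simp only [σ.injective.eq_iff] at h
    rw [Matrix.one_apply, ← h, dotProduct_comm]
    rfl
  refine ⟨V, d ∘ σ, hV, (mul_eq_one_comm_of_card_eq _ _ _ (by simp [hm])).mp hV, fun i => hd _, hσ,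
    ?_⟩
  have h2 : τ * V = V.map star * diagonal fun i => ((d ∘ σ) i : ℂ) := by
    ext a i
    have h := congrArg (fun x : EuclideanSpace ℂ n => star (x.ofLp a)) (hTv (σ i))
    simp only [hTx, Pi.star_apply, star_star] at h
    rw [mul_diagonal]
    change (τ *ᵥ (v (σ i)).ofLp) a = _
    rw [h]
    simp [V, mul_comm]
  have h3 : Vᵀ * V.map star = 1 := by
    have := congrArg transpose hV
    rwa [transpose_mul, transpose_one, conjTranspose, transpose_map, transpose_transpose] at this
  rw [Matrix.mul_assoc, h2, ← Matrix.mul_assoc, h3, Matrix.one_mul]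

/-! ### The spin flip and the concurrence -/

open Matrix Polynomial

/-- The operator `Y ⊗ Y` of the spin flip. -/
def pauliYY : Op := pauliY ⊗ₖ pauliY

theorem pauliYY_conjTranspose : pauliYYᴴ = pauliYY := by
  ext ⟨i, j⟩ ⟨k, l⟩
  fin_cases i <;> fin_cases j <;> fin_cases k <;> fin_cases l <;> simp [pauliYY, pauliY]

theorem pauliYY_transpose : pauliYYᵀ = pauliYY := by
  ext ⟨i, j⟩ ⟨k, l⟩
  fin_cases i <;> fin_cases j <;> fin_cases k <;> fin_cases l <;> simp [pauliYY, pauliY]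

theorem spinFlip_eq (ρ : Op) : spinFlip ρ = pauliYY * ρ.map star * pauliYY := rfl

theorem spinFlip_posSemidef {ρ : Op} (hρ : ρ.PosSemidef) : (spinFlip ρ).PosSemidef := by
  have h : ρ.map star = ρᵀ := by
    conv_rhs => rw [← hρ.isHermitian.eq]
    rw [conjTranspose, transpose_map, transpose_transpose]
  have := hρ.transpose.mul_mul_conjTranspose_same pauliYY
  rwa [pauliYY_conjTranspose, ← h, ← spinFlip_eq] at this

theorem concurrenceMatrix_mul_self {ρ : Op} (hρ : ρ.PosSemidef) :
    concurrenceMatrix ρ * concurrenceMatrix ρ = CFC.sqrt ρ * spinFlip ρ * CFC.sqrt ρ := by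
  have hs : (CFC.sqrt ρ)ᴴ = CFC.sqrt ρ :=
    (nonneg_iff_posSemidef.mp (CFC.sqrt_nonneg ρ)).isHermitian.eq
  have := (spinFlip_posSemidef hρ).mul_mul_conjTranspose_same (CFC.sqrt ρ)
  rw [hs] at this
  exact CFC.sqrt_mul_sqrt_self _ (nonneg_iff_posSemidef.mpr this)

theorem charpoly_mul_self_of_isHermitian {n : Type*} [Fintype n] [DecidableEq n]
    {A : Matrix n n ℂ} (hA : A.IsHermitian) :
    (A * A).charpoly = ∏ i, (X - C ((hA.eigenvalues i : ℂ) ^ 2)) := by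
  conv_lhs =>
    rw [hA.spectral_theorem, ← map_mul, diagonal_mul_diagonal, Unitary.conjStarAlgAut_apply,
      charpoly_mul_comm, ← mul_assoc]
  simp [charpoly_diagonal, sq]

theorem concurrenceEigenvalue_antitone (ρ : Op) : Antitone (concurrenceEigenvalue ρ) :=
  fun _ _ h => (concurrenceMatrix_isHermitian ρ).eigenvalues₀_antitone h

theorem concurrenceEigenvalue_nonneg (ρ : Op) (k : Fin 4) : 0 ≤ concurrenceEigenvalue ρ k := by
  have h := (nonneg_iff_posSemidef.mp (CFC.sqrt_nonneg
    (CFC.sqrt ρ * spinFlip ρ * CFC.sqrt ρ))).eigenvalues_nonneg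
      ((Fintype.equivOfCardEq (Fintype.card_fin _)) (Fin.cast (by simp) k))
  rw [IsHermitian.eigenvalues, Equiv.symm_apply_apply] at h
  exact h

/-- The squares of the numbers `λ₁, …, λ₄` are the eigenvalues of `ρ ρ̃`. -/
theorem charpoly_mul_spinFlip {ρ : Op} (hρ : ρ.PosSemidef) :
    (ρ * spinFlip ρ).charpoly = ∏ k, (X - C ((concurrenceEigenvalue ρ k : ℂ) ^ 2)) := by
  have h1 : (ρ * spinFlip ρ).charpoly = (concurrenceMatrix ρ * concurrenceMatrix ρ).charpoly := by
    rw [concurrenceMatrix_mul_self hρ, charpoly_mul_comm (CFC.sqrt ρ * spinFlip ρ),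
      ← Matrix.mul_assoc, CFC.sqrt_mul_sqrt_self ρ (nonneg_iff_posSemidef.mpr hρ)]
  rw [h1, charpoly_mul_self_of_isHermitian (concurrenceMatrix_isHermitian ρ)]
  refine (Fintype.prod_equiv ((finCongr (by simp)).trans
    (Fintype.equivOfCardEq (Fintype.card_fin _))) _ _ fun k => ?_).symm
  rw [IsHermitian.eigenvalues, Equiv.trans_apply, Equiv.symm_apply_apply]
  rfl

theorem concurrenceEigenvalue_eq_of_charpoly {ρ : Op} (hρ : ρ.PosSemidef) {μ : Fin 4 → ℝ}
    (hμ : Antitone μ) (hμ0 : ∀ k, 0 ≤ μ k)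
    (h : (ρ * spinFlip ρ).charpoly = ∏ k, (X - C ((μ k : ℂ) ^ 2))) :
    concurrenceEigenvalue ρ = μ := by
  have key : ∀ f : Fin 4 → ℝ, (∀ k, 0 ≤ f k) →
      ((∏ k, (X - C ((f k : ℂ) ^ 2))).roots.map fun z : ℂ => Real.sqrt z.re) =
        Finset.univ.val.map f := by
    intro f hf
    have : ∏ k, (X - C ((f k : ℂ) ^ 2)) =
        ((Finset.univ.val.map fun k => (f k : ℂ) ^ 2).map fun a => X - C a).prod := by
      rw [Multiset.map_map]; rfl
    rw [this, roots_multiset_prod_X_sub_C, Multiset.map_map]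
    refine Multiset.map_congr rfl fun k _ => ?_
    simp only [Function.comp, ← Complex.ofReal_pow, Complex.ofReal_re, Real.sqrt_sq (hf k)]
  have h1 := key _ (concurrenceEigenvalue_nonneg ρ)
  rw [← charpoly_mul_spinFlip hρ, h, key _ hμ0, Fin.univ_val_map, Fin.univ_val_map,
    Multiset.coe_eq_coe] at h1
  exact (List.ofFn_injective (h1.eq_of_pairwise' (hμ.sortedGE_ofFn).pairwise
    (concurrenceEigenvalue_antitone ρ).sortedGE_ofFn.pairwise)).symm

theorem concurrence_eq_of_charpoly {ρ : Op} (hρ : ρ.PosSemidef) {μ : Fin 4 → ℝ}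
    (hμ : Antitone μ) (hμ0 : ∀ k, 0 ≤ μ k)
    (h : (ρ * spinFlip ρ).charpoly = ∏ k, (X - C ((μ k : ℂ) ^ 2))) :
    concurrence ρ = max 0 (μ 0 - μ 1 - μ 2 - μ 3) := by
  rw [concurrence, concurrenceEigenvalue_eq_of_charpoly hρ hμ hμ0 h]

theorem concurrence_congr_of_charpoly {ρ ω : Op} (hρ : ρ.PosSemidef) (hω : ω.PosSemidef)
    (h : (ρ * spinFlip ρ).charpoly = (ω * spinFlip ω).charpoly) :
    concurrence ρ = concurrence ω :=
  concurrence_eq_of_charpoly hρ (concurrenceEigenvalue_antitone ω) (concurrenceEigenvalue_nonneg ω)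
    (h.trans (charpoly_mul_spinFlip hω))

/-! ### Local unitaries -/

theorem unitary_mul_conjTranspose (U : unitaryGroup (Fin 2) ℂ) :
    (U : QubitOp) * (U : QubitOp)ᴴ = 1 :=
  mem_unitaryGroup_iff.mp U.2

theorem unitary_conjTranspose_mul (U : unitaryGroup (Fin 2) ℂ) :
    (U : QubitOp)ᴴ * (U : QubitOp) = 1 :=
  mem_unitaryGroup_iff'.mp U.2

theorem kronecker_conjTranspose_mul (U V : unitaryGroup (Fin 2) ℂ) :
    ((U : QubitOp) ⊗ₖ (V : QubitOp))ᴴ * ((U : QubitOp) ⊗ₖ (V : QubitOp)) = 1 := by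
  rw [conjTranspose_kronecker, ← mul_kronecker_mul, unitary_conjTranspose_mul,
    unitary_conjTranspose_mul, one_kronecker_one]

theorem localConj_mul (U V : unitaryGroup (Fin 2) ℂ) (ρ ω : Op) :
    localConj U V ρ * localConj U V ω = localConj U V (ρ * ω) := by
  have h := kronecker_conjTranspose_mul U V
  simp only [localConj]
  set L := (U : QubitOp) ⊗ₖ (V : QubitOp)
  calc L * ρ * Lᴴ * (L * ω * Lᴴ) = L * ρ * (Lᴴ * L) * ω * Lᴴ := by simp only [Matrix.mul_assoc]
    _ = _ := by rw [h, Matrix.mul_one, Matrix.mul_assoc L]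

theorem trace_localConj (U V : unitaryGroup (Fin 2) ℂ) (ρ : Op) :
    (localConj U V ρ).trace = ρ.trace := by
  rw [localConj, trace_mul_comm, ← Matrix.mul_assoc, kronecker_conjTranspose_mul, Matrix.one_mul]

theorem charpoly_localConj (U V : unitaryGroup (Fin 2) ℂ) (ρ : Op) :
    (localConj U V ρ).charpoly = ρ.charpoly := by
  rw [localConj, charpoly_mul_comm, ← Matrix.mul_assoc, kronecker_conjTranspose_mul, Matrix.one_mul]

theorem localConj_localConj (U V U' V' : unitaryGroup (Fin 2) ℂ) (ρ : Op) :
    localConj U V (localConj U' V' ρ) = localConj (U * U') (V * V') ρ := by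
  simp only [localConj, UnitaryGroup.mul_val, mul_kronecker_mul, conjTranspose_mul,
    Matrix.mul_assoc]

theorem localConj_one (ρ : Op) : localConj 1 1 ρ = ρ := by
  simp [localConj]

theorem localConj_inv_localConj (U V : unitaryGroup (Fin 2) ℂ) (ρ : Op) :
    localConj U⁻¹ V⁻¹ (localConj U V ρ) = ρ := by
  rw [localConj_localConj, inv_mul_cancel, inv_mul_cancel, localConj_one]

theorem localConj_localConj_inv (U V : unitaryGroup (Fin 2) ℂ) (ρ : Op) :
    localConj U V (localConj U⁻¹ V⁻¹ ρ) = ρ := by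
  rw [localConj_localConj, mul_inv_cancel, mul_inv_cancel, localConj_one]

theorem IsDensity.localConj {ρ : Op} (hρ : IsDensity ρ) (U V : unitaryGroup (Fin 2) ℂ) :
    IsDensity (localConj U V ρ) :=
  ⟨hρ.1.mul_mul_conjTranspose_same _, (trace_localConj U V ρ).trans hρ.2⟩

/-- The operator `Y` intertwines the complex conjugate of a unitary with the unitary itself, up to
a phase. -/
theorem map_star_mul_pauliY (U : unitaryGroup (Fin 2) ℂ) :
    (U : QubitOp).map star * pauliY = star (U : QubitOp).det • (pauliY * (U : QubitOp)) := by
  have h1 : (U : QubitOp)ᵀ * pauliY * (U : QubitOp) = (U : QubitOp).det • pauliY := by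
    ext i j
    fin_cases i <;> fin_cases j <;>
      simp [pauliY, mul_apply, Fin.sum_univ_two, det_fin_two] <;> ring
  have h2 : (U : QubitOp).map star * (U : QubitOp)ᵀ = 1 := by
    have := congrArg transpose (unitary_mul_conjTranspose U)
    rwa [transpose_mul, transpose_one, conjTranspose, transpose_map, transpose_transpose] at this
  have h3 : star (U : QubitOp).det * (U : QubitOp).det = 1 := by
    rw [← det_conjTranspose, ← det_mul, unitary_conjTranspose_mul, det_one]
  have h4 : pauliY * (U : QubitOp) = (U : QubitOp).det • ((U : QubitOp).map star * pauliY) := by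
    rw [← Matrix.mul_smul, ← h1, ← Matrix.mul_assoc, ← Matrix.mul_assoc, h2, Matrix.one_mul]
  rw [h4, smul_smul, h3, one_smul]

theorem spinFlip_localConj (U V : unitaryGroup (Fin 2) ℂ) (ρ : Op) :
    spinFlip (localConj U V ρ) = localConj U V (spinFlip ρ) := by
  set L : Op := (U : QubitOp) ⊗ₖ (V : QubitOp) with hL
  obtain ⟨c, hc, h1⟩ : ∃ c : ℂ, c * star c = 1 ∧ L.map star * pauliYY = c • (pauliYY * L) := by
    have hdet : ∀ W : unitaryGroup (Fin 2) ℂ, star (W : QubitOp).det * (W : QubitOp).det = 1 :=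
      fun W => by rw [← det_conjTranspose, ← det_mul, unitary_conjTranspose_mul, det_one]
    refine ⟨star (U : QubitOp).det * star (V : QubitOp).det, ?_, ?_⟩
    · rw [star_mul', star_star, star_star]
      linear_combination (star (V : QubitOp).det * (V : QubitOp).det) * hdet U + hdet V
    · have : L.map star = (U : QubitOp).map star ⊗ₖ (V : QubitOp).map star := by
        ext ⟨i, j⟩ ⟨k, l⟩
        simp [hL, kroneckerMap_apply]
      rw [this, pauliYY, ← mul_kronecker_mul, map_star_mul_pauliY, map_star_mul_pauliY, hL,
        ← mul_kronecker_mul, smul_kronecker, kronecker_smul, smul_smul]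
  have hYY : pauliYY * pauliYY = 1 := by
    have : pauliY * pauliY = 1 := by
      ext i j
      fin_cases i <;> fin_cases j <;> simp [pauliY]
    rw [pauliYY, ← mul_kronecker_mul, this, one_kronecker_one]
  have h2 : pauliYY * L.map star = c • (L * pauliYY) := by
    calc pauliYY * L.map star = pauliYY * (L.map star * pauliYY) * pauliYY := by
          rw [Matrix.mul_assoc, Matrix.mul_assoc, hYY, Matrix.mul_one]
      _ = _ := by
          rw [h1, Matrix.mul_smul, ← Matrix.mul_assoc, hYY, Matrix.one_mul, Matrix.smul_mul]
  have h3 : (L.map star)ᴴ * pauliYY = star c • (pauliYY * Lᴴ) := by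
    have := congrArg conjTranspose h2
    rwa [conjTranspose_mul, conjTranspose_smul, conjTranspose_mul, pauliYY_conjTranspose] at this
  have hmap : (localConj U V ρ).map star = L.map star * ρ.map star * (L.map star)ᴴ := by
    have hs : ∀ A B : Op, (A * B).map star = A.map star * B.map star := fun A B =>
      Matrix.map_mul (f := starRingEnd ℂ)
    rw [localConj, hs, hs]
    rfl
  rw [spinFlip_eq, hmap]
  calc pauliYY * (L.map star * ρ.map star * (L.map star)ᴴ) * pauliYY
      = (pauliYY * L.map star) * ρ.map star * ((L.map star)ᴴ * pauliYY) := by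
        simp only [Matrix.mul_assoc]
    _ = (c * star c) • (L * (pauliYY * ρ.map star * pauliYY) * Lᴴ) := by
        rw [h2, h3]
        simp only [Matrix.smul_mul, Matrix.mul_smul, smul_smul, Matrix.mul_assoc, mul_comm]
    _ = _ := by rw [hc, one_smul, ← spinFlip_eq]; rfl

theorem concurrence_localConj {ρ : Op} (hρ : ρ.PosSemidef) (U V : unitaryGroup (Fin 2) ℂ) :
    concurrence (localConj U V ρ) = concurrence ρ :=
  concurrence_congr_of_charpoly (hρ.mul_mul_conjTranspose_same _) hρ <| by
    rw [spinFlip_localConj, localConj_mul, charpoly_localConj]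

/-! ### Decompositions realizing the concurrence -/

/-- Three lengths satisfying the triangle inequalities are the side lengths of a closed triangle
in the complex plane. -/
theorem exists_triangle {a b c : ℝ} (hb : 0 ≤ b) (hba : b ≤ a) (hc : 0 ≤ c) (hca : c ≤ a + b)
    (hac : a ≤ b + c) : ∃ e f : ℂ, ‖e‖ = 1 ∧ ‖f‖ = 1 ∧ (a : ℂ) + e * b + f * c = 0 := by
  obtain ⟨e, he, hec⟩ : ∃ e : ℂ, ‖e‖ = 1 ∧ ‖(a : ℂ) + e * b‖ = c := by
    rcases hb.eq_or_lt with rfl | hb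
    · refine ⟨1, norm_one, ?_⟩
      rw [Complex.ofReal_zero, mul_zero, add_zero, Complex.norm_real, Real.norm_of_nonneg hba]
      linarith
    · have ha : 0 < a := hb.trans_le hba
      -- the law of cosines determines the real part of `e`
      set x : ℝ := (c ^ 2 - a ^ 2 - b ^ 2) / (2 * a * b) with hx
      have hx1 : 2 * a * b * x = c ^ 2 - a ^ 2 - b ^ 2 := by rw [hx]; field_simp
      have hxle : x ≤ 1 := by
        rw [hx, div_le_one (by positivity)]; nlinarith
      have hxge : -1 ≤ x := by
        rw [hx, le_div_iff₀ (by positivity)]; nlinarith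
      have hy : Real.sqrt (1 - x ^ 2) ^ 2 = 1 - x ^ 2 := Real.sq_sqrt (by nlinarith)
      refine ⟨⟨x, Real.sqrt (1 - x ^ 2)⟩, ?_, ?_⟩
      · rw [← sq_eq_sq₀ (norm_nonneg _) zero_le_one, ← Complex.normSq_eq_norm_sq,
          Complex.normSq_mk]
        linarith
      · rw [← sq_eq_sq₀ (norm_nonneg _) hc, ← Complex.normSq_eq_norm_sq, Complex.normSq_apply]
        simp only [Complex.add_re, Complex.add_im, Complex.mul_re, Complex.mul_im,
          Complex.ofReal_re, Complex.ofReal_im]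
        linear_combination hx1 + b ^ 2 * hy
  rcases hc.eq_or_lt with rfl | hc
  · exact ⟨e, 1, he, norm_one, by simpa using hec⟩
  · refine ⟨e, -((a : ℂ) + e * b) / c, he, ?_, ?_⟩
    · rw [norm_div, norm_neg, hec, Complex.norm_real, Real.norm_of_nonneg hc.le, div_self hc.ne']
    · have : (c : ℂ) ≠ 0 := by exact_mod_cast hc.ne'
      field_simp
      ring

/-- Phases can be chosen such that the weighted sum of four nonnegative numbers is as small as the
largest of them permits. -/
theorem exists_phases {d : Fin 4 → ℝ} (hd : Antitone d) (h0 : ∀ i, 0 ≤ d i) :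
    ∃ e : Fin 4 → ℂ, (∀ i, ‖e i‖ = 1) ∧ ‖∑ i, e i * d i‖ = max 0 (d 0 - d 1 - d 2 - d 3) := by
  rcases le_total 0 (d 0 - d 1 - d 2 - d 3) with h | h
  · refine ⟨![1, -1, -1, -1], fun i => by fin_cases i <;> simp, ?_⟩
    have : ∑ i, (![1, -1, -1, -1] : Fin 4 → ℂ) i * d i = ((d 0 - d 1 - d 2 - d 3 : ℝ) : ℂ) := by
      simp [Fin.sum_univ_four]
      ring
    rw [this, Complex.norm_real, Real.norm_of_nonneg h, max_eq_right h]
  · have h01 : d 1 ≤ d 0 := hd (by decide)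
    have h02 : d 2 ≤ d 0 := hd (by decide)
    have h13 : d 3 ≤ d 1 := hd (by decide)
    obtain ⟨e, f, he, hf, hef⟩ := exists_triangle (h0 1) h01 (add_nonneg (h0 2) (h0 3))
      (by linarith) (by linarith)
    refine ⟨![1, e, f, f], fun i => by fin_cases i <;> simp [he, hf], ?_⟩
    have : ∑ i, (![1, e, f, f] : Fin 4 → ℂ) i * d i = 0 := by
      rw [← hef]
      simp [Fin.sum_univ_four]
      ring
    rw [this, norm_zero, max_eq_left h]

/-- The concurrence computed from a Takagi factorization of `Wᵀ (Y ⊗ Y) W`, where `ρ = W W†`. -/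
theorem concurrence_eq_of_takagi {ρ W : Op} (hW : W * Wᴴ = ρ)
    {V : Matrix (Fin 2 × Fin 2) (Fin 4) ℂ} {d : Fin 4 → ℝ} (hV : Vᴴ * V = 1) (hV' : V * Vᴴ = 1)
    (h0 : ∀ i, 0 ≤ d i) (hd : Antitone d)
    (h : Vᵀ * (Wᵀ * pauliYY * W) * V = diagonal fun i => (d i : ℂ)) :
    concurrence ρ = max 0 (d 0 - d 1 - d 2 - d 3) := by
  refine concurrence_eq_of_charpoly (hW ▸ posSemidef_self_mul_conjTranspose W) hd h0 ?_
  set τ := Wᵀ * pauliYY * W with hτ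
  have hVt : V.map star * Vᵀ = 1 := by
    have := congrArg transpose hV'
    rwa [transpose_mul, transpose_one, conjTranspose, transpose_map, transpose_transpose] at this
  have hτV : τ * V = V.map star * diagonal fun i => (d i : ℂ) := by
    rw [← h, ← Matrix.mul_assoc, ← Matrix.mul_assoc, hVt, Matrix.one_mul]
  have hVτ : Vᴴ * τᴴ = (diagonal fun i => (d i : ℂ)) * Vᵀ := by
    have := congrArg conjTranspose hτV
    rw [conjTranspose_mul τ V, conjTranspose_mul (V.map star), diagonal_conjTranspose] at this
    rw [this]
    congr 1
    · congr 1; ext i; simp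
    · ext i j; simp
  have hτ' : τᴴ = Wᴴ * pauliYY * W.map star := by
    rw [hτ, conjTranspose_mul, conjTranspose_mul, pauliYY_conjTranspose, Matrix.mul_assoc]
    congr 2
  have hρ : ρ.map star = W.map star * Wᵀ := by
    have hs : (W * Wᴴ).map star = W.map star * (Wᴴ).map star := Matrix.map_mul (f := starRingEnd ℂ)
    rw [← hW, hs]
    congr 1
    ext i j; simp
  calc (ρ * spinFlip ρ).charpoly
      = (W * (Wᴴ * pauliYY * W.map star * (Wᵀ * pauliYY))).charpoly := by
        rw [spinFlip_eq, hρ, ← hW]; simp only [Matrix.mul_assoc]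
    _ = (τᴴ * τ).charpoly := by
        rw [charpoly_mul_comm, hτ', hτ, Matrix.mul_assoc _ _ W]
    _ = (V * (Vᴴ * (τᴴ * τ))).charpoly := by
        rw [← Matrix.mul_assoc V, hV', Matrix.one_mul]
    _ = (Vᴴ * (τᴴ * τ) * V).charpoly := by
        rw [charpoly_mul_comm_of_le _ _ (by simp)]
        simp
    _ = (diagonal fun i => ((d i : ℂ) ^ 2)).charpoly := by
        rw [← Matrix.mul_assoc, hVτ, Matrix.mul_assoc, hτV, Matrix.mul_assoc,
          ← Matrix.mul_assoc Vᵀ]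
        have : Vᵀ * V.map star = 1 := by
          have := congrArg transpose hV
          rwa [transpose_mul, transpose_one, conjTranspose, transpose_map, transpose_transpose]
            at this
        rw [this, Matrix.one_mul, diagonal_mul_diagonal]
        simp only [sq]
    _ = _ := charpoly_diagonal _

/-- A `4 × 4` Hadamard matrix, normalized to be orthogonal. -/
noncomputable def hadamard : Matrix (Fin 4) (Fin 4) ℂ :=
  (1 / 2 : ℂ) • !![1, 1, 1, 1; 1, -1, 1, -1; 1, 1, -1, -1; 1, -1, -1, 1]

theorem hadamard_mul_conjTranspose : hadamard * hadamardᴴ = 1 := by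
  have h2 : (starRingEnd ℂ) 2 = 2 := map_ofNat _ 2
  ext i j
  fin_cases i <;> fin_cases j <;>
    simp [hadamard, mul_apply, Fin.sum_univ_four, h2] <;> norm_num

theorem hadamard_apply_mul_self (i j : Fin 4) : hadamard i j * hadamard i j = 1 / 4 := by
  fin_cases i <;> fin_cases j <;> simp [hadamard] <;> norm_num

/-- Every positive operator is a sum of four operators `|z⟩⟨z|` for which the numbers
`|zᵀ (Y ⊗ Y) z|` add up to the concurrence. The phases in the Takagi factorization are chosen such
that the trace is minimal, and the Hadamard matrix spreads the trace evenly over the diagonal. -/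
theorem exists_decomposition {ρ : Op} (hρ : ρ.PosSemidef) :
    ∃ Z : Matrix (Fin 2 × Fin 2) (Fin 4) ℂ, Z * Zᴴ = ρ ∧
      ∑ k, ‖(Zᵀ * pauliYY * Z) k k‖ = concurrence ρ := by
  set W : Op := CFC.sqrt ρ with hWdef
  have hWh : Wᴴ = W := (nonneg_iff_posSemidef.mp (CFC.sqrt_nonneg ρ)).isHermitian.eq
  have hW : W * Wᴴ = ρ := by
    rw [hWh]; exact CFC.sqrt_mul_sqrt_self ρ (nonneg_iff_posSemidef.mpr hρ)
  obtain ⟨V, d, hV, hV', h0, hd, h⟩ := exists_takagi (m := 4) (by simp) (Wᵀ * pauliYY * W) (by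
    rw [transpose_mul, transpose_mul, transpose_transpose, pauliYY_transpose, Matrix.mul_assoc])
  obtain ⟨e, he, hsum⟩ := exists_phases hd h0
  choose s hs using fun i => IsAlgClosed.exists_pow_nat_eq (e i) (n := 2) (by norm_num)
  have hs1 : ∀ i, ‖s i‖ = 1 := fun i => by
    have := he i
    rw [← hs i, norm_pow] at this
    exact (pow_eq_one_iff_of_nonneg (norm_nonneg _) two_ne_zero).mp this
  have hS : diagonal s * (diagonal s)ᴴ = 1 := by
    rw [diagonal_conjTranspose, diagonal_mul_diagonal, ← diagonal_one]
    congr 1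
    ext i
    rw [Pi.star_apply, Complex.star_def, Complex.mul_conj, Complex.normSq_eq_norm_sq, hs1]
    simp
  refine ⟨W * V * diagonal s * hadamard, ?_, ?_⟩
  · calc W * V * diagonal s * hadamard * (W * V * diagonal s * hadamard)ᴴ
        = W * (V * (diagonal s * (hadamard * hadamardᴴ) * (diagonal s)ᴴ) * Vᴴ) * Wᴴ := by
          simp only [conjTranspose_mul, Matrix.mul_assoc]
      _ = ρ := by
          rw [hadamard_mul_conjTranspose, Matrix.mul_one, hS, Matrix.mul_one, hV', Matrix.mul_one,
            hW]
  · have hZ : (W * V * diagonal s * hadamard)ᵀ * pauliYY * (W * V * diagonal s * hadamard) =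
        hadamardᵀ * (diagonal fun i => e i * d i) * hadamard := by
      calc _ = hadamardᵀ * (diagonal s * (Vᵀ * (Wᵀ * pauliYY * W) * V) * diagonal s) *
            hadamard := by
            simp only [transpose_mul, diagonal_transpose, Matrix.mul_assoc]
        _ = _ := by
            rw [h, diagonal_mul_diagonal, diagonal_mul_diagonal]
            congr 3
            ext i
            rw [← hs i]
            ring
    have hkk : ∀ k, (hadamardᵀ * (diagonal fun i => e i * d i) * hadamard) k k =
        1 / 4 * ∑ i, e i * d i := by
      intro k
      rw [Matrix.mul_apply, Finset.mul_sum]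
      refine Finset.sum_congr rfl fun i _ => ?_
      rw [mul_diagonal, transpose_apply, ← hadamard_apply_mul_self i k]
      ring
    simp only [hZ, hkk, norm_mul, hsum]
    rw [concurrence_eq_of_takagi hW hV hV' h0 hd h]
    simp

/-- For a vector `z`, the modulus `|zᵀ (Y ⊗ Y) z| = 2 |z₀₀ z₁₁ - z₀₁ z₁₀|` bounds the expectation of
the operator `2 |Φ⟩⟨Φ| - 1` with `Φ = (|00⟩ + |11⟩) / √2`; summing over a decomposition realizing
the concurrence gives the same for every positive operator. -/
theorem fidelity_le_concurrence {ρ : Op} (hρ : ρ.PosSemidef) :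
    2 * (ρ (0, 0) (1, 1)).re - (ρ (0, 1) (0, 1)).re - (ρ (1, 0) (1, 0)).re ≤ concurrence ρ := by
  obtain ⟨Z, hZ, hsum⟩ := exists_decomposition hρ
  rw [← hsum, ← hZ]
  simp only [Matrix.mul_apply, conjTranspose_apply, Complex.re_sum]
  rw [Finset.mul_sum, ← Finset.sum_sub_distrib, ← Finset.sum_sub_distrib]
  refine Finset.sum_le_sum fun k _ => ?_
  have h1 : ((Zᵀ * pauliYY * Z) k k) =
      2 * (Z (0, 1) k * Z (1, 0) k - Z (0, 0) k * Z (1, 1) k) := by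
    simp [Matrix.mul_apply, Fintype.sum_prod_type, Fin.sum_univ_two, pauliYY, pauliY]
    ring_nf
  have h2 : (Z (0, 0) k * star (Z (1, 1) k)).re ≤ ‖Z (0, 0) k‖ * ‖Z (1, 1) k‖ :=
    (Complex.re_le_norm _).trans_eq (by simp)
  have h3 : ∀ w : ℂ, (w * star w).re = ‖w‖ ^ 2 := fun w => by
    rw [Complex.star_def, Complex.mul_conj, Complex.ofReal_re, Complex.normSq_eq_norm_sq]
  have h4 := norm_sub_norm_le (Z (0, 0) k * Z (1, 1) k) (Z (0, 1) k * Z (1, 0) k)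
  have h5 := two_mul_le_add_sq ‖Z (0, 1) k‖ ‖Z (1, 0) k‖
  have h6 := congrArg norm h1
  rw [norm_mul, norm_sub_rev, Complex.norm_ofNat] at h6
  simp only [Matrix.mul_apply] at h6
  rw [norm_mul, norm_mul] at h4
  simp only [h3]
  rw [h6]
  linarith

/-! ### Observables -/

theorem pauliDot_eq (a : EuclideanSpace ℝ (Fin 3)) :
    pauliDot a = !![(a 2 : ℂ), a 0 - a 1 * Complex.I; a 0 + a 1 * Complex.I, -(a 2 : ℂ)] := by
  ext i j
  fin_cases i <;> fin_cases j <;> simp [pauliDot, pauliX, pauliY, pauliZ]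
  ring

theorem pauliDot_add (a b : EuclideanSpace ℝ (Fin 3)) :
    pauliDot (a + b) = pauliDot a + pauliDot b := by
  simp only [pauliDot, PiLp.add_apply, Complex.ofReal_add]
  module

theorem pauliDot_smul (r : ℝ) (a : EuclideanSpace ℝ (Fin 3)) :
    pauliDot (r • a) = (r : ℂ) • pauliDot a := by
  simp only [pauliDot, PiLp.smul_apply, smul_eq_mul, Complex.ofReal_mul]
  module

theorem pauliDot_sub (a b : EuclideanSpace ℝ (Fin 3)) :
    pauliDot (a - b) = pauliDot a - pauliDot b := by
  simp only [pauliDot, PiLp.sub_apply, Complex.ofReal_sub]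
  module

theorem pauliDot_anticommutator (a b : EuclideanSpace ℝ (Fin 3)) :
    pauliDot a * pauliDot b + pauliDot b * pauliDot a = (2 * inner ℝ a b : ℂ) • (1 : QubitOp) := by
  have h : inner ℝ a b = a 0 * b 0 + a 1 * b 1 + a 2 * b 2 := by
    simp [PiLp.inner_apply, Fin.sum_univ_three]
    ring
  rw [h, pauliDot_eq, pauliDot_eq]
  ext i j
  fin_cases i <;> fin_cases j <;> simp <;> ring_nf <;>
    simp only [Complex.I_sq] <;> ring

theorem pauliDot_mul_self {a : EuclideanSpace ℝ (Fin 3)} (ha : ‖a‖ = 1) :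
    pauliDot a * pauliDot a = 1 := by
  have h := pauliDot_anticommutator a a
  rw [real_inner_self_eq_norm_sq, ha, ← two_smul ℂ] at h
  simpa using h

theorem pauliDot_conjTranspose (a : EuclideanSpace ℝ (Fin 3)) : (pauliDot a)ᴴ = pauliDot a := by
  rw [pauliDot_eq]
  ext i j
  fin_cases i <;> fin_cases j <;> simp [sub_eq_add_neg]

/-- Observables are the Hermitian traceless operators with square one; in this form the invariance
under unitary conjugation is evident. -/
theorem isObservable_iff (A : QubitOp) :
    IsObservable A ↔ Aᴴ = A ∧ A.trace = 0 ∧ A * A = 1 := by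
  constructor
  · rintro ⟨a, ha, rfl⟩
    refine ⟨pauliDot_conjTranspose a, ?_, pauliDot_mul_self ha⟩
    simp [pauliDot_eq, trace_fin_two]
  · rintro ⟨h1, h2, h3⟩
    let a : EuclideanSpace ℝ (Fin 3) := !₂[(A 1 0).re, (A 1 0).im, (A 0 0).re]
    have h00 : A 0 0 = ((A 0 0).re : ℂ) := by
      have := congrFun (congrFun h1 0) 0
      rw [conjTranspose_apply] at this
      exact (Complex.conj_eq_iff_re.mp this).symm
    have h10 : A 1 0 = (A 1 0).re + (A 1 0).im * Complex.I := (Complex.re_add_im _).symm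
    have h01 : A 0 1 = (A 1 0).re - (A 1 0).im * Complex.I := by
      have := congrFun (congrFun h1 0) 1
      rw [conjTranspose_apply] at this
      rw [← this]
      apply Complex.ext <;> simp
    have h11 : A 1 1 = -((A 0 0).re : ℂ) := by
      rw [trace_fin_two] at h2
      rw [← h00]
      linear_combination h2
    have hA : A = pauliDot a := by
      rw [pauliDot_eq]
      ext i j
      fin_cases i <;> fin_cases j
      · simpa [a] using h00
      · simpa [a] using h01
      · simp [a]
      · simpa [a] using h11
    refine ⟨a, ?_, hA⟩
    have h := pauliDot_anticommutator a a
    rw [← hA, h3, real_inner_self_eq_norm_sq] at h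
    have h' := congrFun (congrFun h 0) 0
    simp only [Matrix.add_apply, one_apply_eq, Matrix.smul_apply, smul_eq_mul, mul_one] at h'
    have h'' : (‖a‖ ^ 2 : ℝ) = 1 := by
      have : ((‖a‖ ^ 2 : ℝ) : ℂ) = 1 := by linear_combination -h' / 2
      exact_mod_cast this
    exact (pow_eq_one_iff_of_nonneg (norm_nonneg _) two_ne_zero).mp h''

theorem IsObservable.unitary_conj {A : QubitOp} (hA : IsObservable A)
    (U : unitaryGroup (Fin 2) ℂ) : IsObservable ((U : QubitOp) * A * (U : QubitOp)ᴴ) := by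
  rw [isObservable_iff] at hA ⊢
  obtain ⟨h1, h2, h3⟩ := hA
  refine ⟨?_, ?_, ?_⟩
  · rw [conjTranspose_mul, conjTranspose_mul, h1, conjTranspose_conjTranspose, Matrix.mul_assoc]
  · rw [trace_mul_comm, ← Matrix.mul_assoc, unitary_conjTranspose_mul, Matrix.one_mul, h2]
  · calc (U : QubitOp) * A * (U : QubitOp)ᴴ * ((U : QubitOp) * A * (U : QubitOp)ᴴ)
        = (U : QubitOp) * A * ((U : QubitOp)ᴴ * (U : QubitOp)) * A * (U : QubitOp)ᴴ := by
          simp only [Matrix.mul_assoc]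
      _ = 1 := by
          rw [unitary_conjTranspose_mul, Matrix.mul_one, Matrix.mul_assoc (U : QubitOp), h3,
            Matrix.mul_one, unitary_mul_conjTranspose]

theorem isObservable_pauliX : IsObservable pauliX := by
  rw [isObservable_iff]
  refine ⟨?_, by simp [pauliX, trace_fin_two], ?_⟩ <;> ext i j <;>
    fin_cases i <;> fin_cases j <;> simp [pauliX]

theorem isObservable_pauliZ : IsObservable pauliZ := by
  rw [isObservable_iff]
  refine ⟨?_, by simp [pauliZ, trace_fin_two], ?_⟩ <;> ext i j <;>
    fin_cases i <;> fin_cases j <;> simp [pauliZ]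

/-- Every observable is unitarily equivalent to `Z`. Unless the observable `A` is `-Z`, the
operator `A + Z` is a multiple of a Hermitian unitary which exchanges `A` and `Z`. -/
theorem exists_unitary_conj_pauliZ {A : QubitOp} (hA : IsObservable A) :
    ∃ U : unitaryGroup (Fin 2) ℂ, (U : QubitOp) * pauliZ * (U : QubitOp)ᴴ = A := by
  obtain ⟨a, ha, rfl⟩ := hA
  have hsq : a 0 ^ 2 + a 1 ^ 2 + a 2 ^ 2 = 1 := by
    have := EuclideanSpace.real_norm_sq_eq a
    rw [ha, Fin.sum_univ_three] at this
    linarith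
  have hX := (isObservable_iff _).mp isObservable_pauliX
  have hZ := (isObservable_iff _).mp isObservable_pauliZ
  by_cases h2 : a 2 = -1
  · have h0 : a 0 = 0 := by nlinarith
    have h1 : a 1 = 0 := by nlinarith
    refine ⟨⟨pauliX, mem_unitaryGroup_iff.mpr ?_⟩, ?_⟩
    · rw [star_eq_conjTranspose, hX.1, hX.2.2]
    · change pauliX * pauliZ * pauliXᴴ = _
      rw [pauliDot_eq, h0, h1, h2, hX.1]
      ext i j
      fin_cases i <;> fin_cases j <;> simp [pauliX, pauliZ]
  · have hpos : 0 < 2 * (1 + a 2) := by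
      have : -1 ≤ a 2 := by nlinarith [sq_nonneg (a 0), sq_nonneg (a 1)]
      have := lt_of_le_of_ne this (Ne.symm h2)
      linarith
    set A := pauliDot a with hAdef
    have hAA : A * A = 1 := pauliDot_mul_self ha
    have hsum : (A + pauliZ) * (A + pauliZ) = ((2 * (1 + a 2) : ℝ) : ℂ) • (1 : QubitOp) := by
      have h1 : A * pauliZ + pauliZ * A = (2 * a 2 : ℂ) • (1 : QubitOp) := by
        rw [hAdef, pauliDot_eq]
        ext i j
        fin_cases i <;> fin_cases j <;> simp [pauliZ] <;> ring
      calc (A + pauliZ) * (A + pauliZ) = A * A + (A * pauliZ + pauliZ * A) + pauliZ * pauliZ := by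
            noncomm_ring
        _ = _ := by
            rw [hAA, h1, hZ.2.2]
            push_cast
            module
    set r : ℝ := (Real.sqrt (2 * (1 + a 2)))⁻¹ with hr
    have hrr : (r : ℂ) * r * ((2 * (1 + a 2) : ℝ) : ℂ) = 1 := by
      have : r * r * (2 * (1 + a 2)) = 1 := by
        rw [hr, ← mul_inv, Real.mul_self_sqrt hpos.le, inv_mul_cancel₀ hpos.ne']
      exact_mod_cast this
    have hself : ((r : ℂ) • (A + pauliZ))ᴴ = (r : ℂ) • (A + pauliZ) := by
      rw [conjTranspose_smul, conjTranspose_add, hZ.1, pauliDot_conjTranspose, Complex.star_def,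
        Complex.conj_ofReal]
    refine ⟨⟨(r : ℂ) • (A + pauliZ), mem_unitaryGroup_iff.mpr ?_⟩, ?_⟩
    · rw [star_eq_conjTranspose, hself, smul_mul_smul_comm, hsum, smul_smul, hrr, one_smul]
    · change (r : ℂ) • (A + pauliZ) * pauliZ * ((r : ℂ) • (A + pauliZ))ᴴ = A
      have h1 : (A + pauliZ) * pauliZ = A * (A + pauliZ) := by
        rw [add_mul, mul_add, hAA, hZ.2.2, add_comm]
      rw [hself, Matrix.smul_mul, smul_mul_smul_comm, h1, Matrix.mul_assoc, hsum, Matrix.mul_smul,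
        smul_smul, hrr, one_smul, Matrix.mul_one]

/-- Every anticommuting pair of observables is simultaneously unitarily equivalent to `Z` and `X`.
Once the first one is `Z`, the second one is off-diagonal, and its phase is removed by a diagonal
unitary. -/
theorem exists_unitary_conj_pair {A B : QubitOp} (hA : IsObservable A) (hB : IsObservable B)
    (hAB : A * B + B * A = 0) : ∃ U : unitaryGroup (Fin 2) ℂ,
      (U : QubitOp) * pauliZ * (U : QubitOp)ᴴ = A ∧
      (U : QubitOp) * pauliX * (U : QubitOp)ᴴ = B := by
  obtain ⟨U, hU⟩ := exists_unitary_conj_pauliZ hA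
  have hB' := hB.unitary_conj U⁻¹
  have hinv : ((U⁻¹ : unitaryGroup (Fin 2) ℂ) : QubitOp) = (U : QubitOp)ᴴ := rfl
  rw [hinv, conjTranspose_conjTranspose] at hB'
  obtain ⟨b, hb, hBb⟩ := hB'
  have hBU : (U : QubitOp) * pauliDot b * (U : QubitOp)ᴴ = B := by
    rw [← hBb]
    calc (U : QubitOp) * ((U : QubitOp)ᴴ * B * (U : QubitOp)) * (U : QubitOp)ᴴ
        = ((U : QubitOp) * (U : QubitOp)ᴴ) * B * ((U : QubitOp) * (U : QubitOp)ᴴ) := by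
          simp only [Matrix.mul_assoc]
      _ = B := by rw [unitary_mul_conjTranspose, Matrix.one_mul, Matrix.mul_one]
  have hanti : pauliZ * pauliDot b + pauliDot b * pauliZ = 0 := by
    have h : ∀ M N : QubitOp, ((U : QubitOp) * M * (U : QubitOp)ᴴ) *
        ((U : QubitOp) * N * (U : QubitOp)ᴴ) = (U : QubitOp) * (M * N) * (U : QubitOp)ᴴ := by
      intro M N
      calc _ = (U : QubitOp) * M * ((U : QubitOp)ᴴ * (U : QubitOp)) * N * (U : QubitOp)ᴴ := by
            simp only [Matrix.mul_assoc]
        _ = _ := by rw [unitary_conjTranspose_mul, Matrix.mul_one, Matrix.mul_assoc (U : QubitOp)]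
    rw [← hU, ← hBU, h, h, ← add_mul, ← mul_add] at hAB
    have := congrArg (fun M => (U : QubitOp)ᴴ * M * (U : QubitOp)) hAB
    simp only [Matrix.mul_zero, Matrix.zero_mul] at this
    rw [← this]
    simp only [← Matrix.mul_assoc, unitary_conjTranspose_mul, Matrix.one_mul]
    rw [Matrix.mul_assoc, unitary_conjTranspose_mul, Matrix.mul_one]
  have hb2 : b 2 = 0 := by
    have := congrFun (congrFun hanti 0) 0
    rw [pauliDot_eq] at this
    simpa [pauliZ, ← two_mul] using this
  set β : ℂ := b 0 + b 1 * Complex.I with hβ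
  have hββ : β * star β = 1 := by
    have h1 := EuclideanSpace.real_norm_sq_eq b
    rw [hb, Fin.sum_univ_three, hb2] at h1
    rw [Complex.star_def, Complex.mul_conj, Complex.normSq_add_mul_I]
    norm_cast
    linarith
  have hG : (diagonal ![1, β] : QubitOp) ∈ unitaryGroup (Fin 2) ℂ := by
    rw [mem_unitaryGroup_iff, star_eq_conjTranspose, diagonal_conjTranspose, diagonal_mul_diagonal,
      ← diagonal_one]
    congr 1
    ext i
    fin_cases i
    · simp
    · simpa using hββ
  let G : unitaryGroup (Fin 2) ℂ := ⟨_, hG⟩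
  have hGval : (G : QubitOp) = !![1, 0; 0, β] := by
    ext i j
    fin_cases i <;> fin_cases j <;> simp [G]
  have hββ' : β * (starRingEnd ℂ) β = 1 := hββ
  have hGZ : (G : QubitOp) * pauliZ * (G : QubitOp)ᴴ = pauliZ := by
    rw [hGval]
    ext i j
    fin_cases i <;> fin_cases j <;>
      simp [mul_apply, Fin.sum_univ_two, pauliZ, hββ']
  have hGX : (G : QubitOp) * pauliX * (G : QubitOp)ᴴ = pauliDot b := by
    rw [hGval, pauliDot_eq, hb2]
    ext i j
    fin_cases i <;> fin_cases j <;>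
      simp [mul_apply, Fin.sum_univ_two, pauliX, hβ, sub_eq_add_neg]
  have hUG : ∀ M : QubitOp, ((U * G : unitaryGroup (Fin 2) ℂ) : QubitOp) * M *
      ((U * G : unitaryGroup (Fin 2) ℂ) : QubitOp)ᴴ =
      (U : QubitOp) * ((G : QubitOp) * M * (G : QubitOp)ᴴ) * (U : QubitOp)ᴴ := by
    intro M
    rw [UnitaryGroup.mul_val, conjTranspose_mul]
    simp only [Matrix.mul_assoc]
  exact ⟨U * G, by rw [hUG, hGZ, hU], by rw [hUG, hGX, hBU]⟩

theorem localConj_kronecker (U V : unitaryGroup (Fin 2) ℂ) (A B : QubitOp) :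
    localConj U V (A ⊗ₖ B) =
      ((U : QubitOp) * A * (U : QubitOp)ᴴ) ⊗ₖ ((V : QubitOp) * B * (V : QubitOp)ᴴ) := by
  rw [localConj, conjTranspose_kronecker, ← mul_kronecker_mul, ← mul_kronecker_mul]

theorem localConj_add (U V : unitaryGroup (Fin 2) ℂ) (ρ ω : Op) :
    localConj U V (ρ + ω) = localConj U V ρ + localConj U V ω := by
  simp only [localConj, Matrix.mul_add, Matrix.add_mul]

theorem localConj_smul (U V : unitaryGroup (Fin 2) ℂ) (c : ℂ) (ρ : Op) :
    localConj U V (c • ρ) = c • localConj U V ρ := by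
  simp only [localConj, Matrix.mul_smul, Matrix.smul_mul]

theorem IsCHSHOperator.localConj {S : Op} (hS : IsCHSHOperator S) (U V : unitaryGroup (Fin 2) ℂ) :
    IsCHSHOperator (localConj U V S) := by
  obtain ⟨A, A', B, B', hA, hA', hB, hB', rfl⟩ := hS
  refine ⟨_, _, _, _, hA.unitary_conj U, hA'.unitary_conj U, hB.unitary_conj V, hB'.unitary_conj V,
    ?_⟩
  rw [localConj_add, localConj_kronecker, localConj_kronecker]
  simp only [Matrix.mul_add, Matrix.add_mul, Matrix.mul_sub, Matrix.sub_mul]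

/-! ### A normal form of CHSH operators -/

theorem exists_unit_smul_eq {x z : EuclideanSpace ℝ (Fin 3)} (h : inner ℝ z x = 0) :
    ∃ u : EuclideanSpace ℝ (Fin 3), ‖u‖ = 1 ∧ inner ℝ z u = 0 ∧ x = ‖x‖ • u := by
  by_cases hx : x = 0
  · have hne : (ℝ ∙ z)ᗮ ≠ ⊥ := by
      intro hbot
      have h1 := Submodule.finrank_add_finrank_orthogonal (ℝ ∙ z)
      have h2 := finrank_span_le_card (R := ℝ) ({z} : Set (EuclideanSpace ℝ (Fin 3)))
      rw [hbot, finrank_bot, finrank_euclideanSpace_fin] at h1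
      simp only [Set.toFinset_singleton, Finset.card_singleton] at h2
      omega
    obtain ⟨y, hy, hy0⟩ := Submodule.exists_mem_ne_zero_of_ne_bot hne
    refine ⟨‖y‖⁻¹ • y, norm_smul_inv_norm hy0, ?_, by simp [hx]⟩
    rw [inner_smul_right, Submodule.mem_orthogonal_singleton_iff_inner_right.mp hy, mul_zero]
  · refine ⟨‖x‖⁻¹ • x, norm_smul_inv_norm hx, by rw [inner_smul_right, h, mul_zero], ?_⟩
    rw [smul_smul, mul_inv_cancel₀ (norm_ne_zero_iff.mpr hx), one_smul]

/-- Orthogonal vectors are nonnegative multiples of orthonormal vectors. -/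
theorem exists_orthonormal_smul_eq {x y : EuclideanSpace ℝ (Fin 3)} (h : inner ℝ x y = 0) :
    ∃ u v : EuclideanSpace ℝ (Fin 3), ‖u‖ = 1 ∧ ‖v‖ = 1 ∧ inner ℝ u v = 0 ∧
      x = ‖x‖ • u ∧ y = ‖y‖ • v := by
  obtain ⟨u, hu, hyu, hxu⟩ := exists_unit_smul_eq (x := x) (z := y) (by rwa [real_inner_comm])
  obtain ⟨v, hv, huv, hyv⟩ := exists_unit_smul_eq (x := y) (z := u) (by rwa [real_inner_comm])
  exact ⟨u, v, hu, hv, huv, hxu, hyv⟩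

/-- A quadratic form in the plane has an off-diagonal entry that vanishes after a rotation. -/
theorem exists_angle (p q : ℝ) :
    ∃ t : ℝ, p * (Real.cos t ^ 2 - Real.sin t ^ 2) + q * (Real.cos t * Real.sin t) = 0 := by
  let z : ℂ := ⟨q, -(2 * p)⟩
  refine ⟨z.arg / 2, ?_⟩
  have h1 : ‖z‖ * Real.cos z.arg = q := Complex.norm_mul_cos_arg z
  have h2 : ‖z‖ * Real.sin z.arg = -(2 * p) := Complex.norm_mul_sin_arg z
  have h3 := Real.cos_two_mul' (z.arg / 2)
  have h4 := Real.sin_two_mul (z.arg / 2)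
  rw [mul_div_cancel₀ _ (two_ne_zero' ℝ)] at h3 h4
  rw [← h3]
  by_cases hz : ‖z‖ = 0
  · rw [hz, zero_mul] at h1 h2
    rw [← h1, show p = 0 by linarith]
    ring
  · refine mul_left_cancel₀ hz ?_
    rw [mul_zero]
    linear_combination p * h1 + q / 2 * h2 - ‖z‖ * q / 2 * h4

/-- The operator `2 c Z ⊗ Z + 2 s X ⊗ X`. -/
noncomputable def chshNormalForm (c s : ℝ) : Op :=
  (2 * c : ℂ) • (pauliZ ⊗ₖ pauliZ) + (2 * s : ℂ) • (pauliX ⊗ₖ pauliX)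

theorem exists_localConj_eq_of_orthonormal {u u' v v' : EuclideanSpace ℝ (Fin 3)} (hu : ‖u‖ = 1)
    (hu' : ‖u'‖ = 1) (huu' : inner ℝ u u' = 0) (hv : ‖v‖ = 1) (hv' : ‖v'‖ = 1)
    (hvv' : inner ℝ v v' = 0) (c s : ℝ) :
    ∃ U V : unitaryGroup (Fin 2) ℂ, localConj U V (chshNormalForm c s) =
      (2 * c : ℂ) • (pauliDot u ⊗ₖ pauliDot v) + (2 * s : ℂ) • (pauliDot u' ⊗ₖ pauliDot v') := by
  obtain ⟨U, hU, hU'⟩ := exists_unitary_conj_pair ⟨u, hu, rfl⟩ ⟨u', hu', rfl⟩ (by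
    rw [pauliDot_anticommutator, huu']; simp)
  obtain ⟨V, hV, hV'⟩ := exists_unitary_conj_pair ⟨v, hv, rfl⟩ ⟨v', hv', rfl⟩ (by
    rw [pauliDot_anticommutator, hvv']; simp)
  refine ⟨U, V, ?_⟩
  rw [chshNormalForm, localConj_add, localConj_smul, localConj_smul, localConj_kronecker,
    localConj_kronecker, hU, hU', hV, hV']

/-- Up to local unitaries, every CHSH operator is `2 c Z ⊗ Z + 2 s X ⊗ X` with `c ≥ s ≥ 0` and
`c² + s² = 1`. This is the singular value decomposition of the coefficient matrix
`a ⊗ (b + b') + a' ⊗ (b - b')`, whose rank is at most two: the vectors `b + b'` and `b - b'` are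
orthogonal, and a rotation in their span makes the left factors orthogonal too. -/
theorem IsCHSHOperator.exists_normalForm {S : Op} (hS : IsCHSHOperator S) :
    ∃ (U V : unitaryGroup (Fin 2) ℂ) (c s : ℝ), 0 ≤ s ∧ s ≤ c ∧ c ^ 2 + s ^ 2 = 1 ∧
      S = TwoQubit.localConj U V (chshNormalForm c s) := by
  obtain ⟨_, _, _, _, ⟨a, ha, rfl⟩, ⟨a', ha', rfl⟩, ⟨b, hb, rfl⟩, ⟨b', hb', rfl⟩, rfl⟩ := hS
  have hbb : inner ℝ (b + b') (b - b') = 0 := by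
    rw [real_inner_add_sub_eq_zero_iff, hb, hb']
  obtain ⟨n, n', hn, hn', hnn', hm, hm'⟩ := exists_orthonormal_smul_eq hbb
  have hkl : ‖b + b'‖ ^ 2 + ‖b - b'‖ ^ 2 = 4 := by
    have := parallelogram_law_with_norm ℝ b b'
    rw [hb, hb'] at this
    linarith
  rw [← pauliDot_add, ← pauliDot_sub, hm, hm']
  set k := ‖b + b'‖
  set l := ‖b - b'‖
  obtain ⟨t, ht⟩ := exists_angle (k * l * inner ℝ a a') (l ^ 2 - k ^ 2)
  have hcs := Real.cos_sq_add_sin_sq t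
  set C := Real.cos t
  set D := Real.sin t
  have haa : inner ℝ a a = (1 : ℝ) := by rw [real_inner_self_eq_norm_sq, ha, one_pow]
  have haa' : inner ℝ a' a' = (1 : ℝ) := by rw [real_inner_self_eq_norm_sq, ha', one_pow]
  have hnn : inner ℝ n n = (1 : ℝ) := by rw [real_inner_self_eq_norm_sq, hn, one_pow]
  have hn'n' : inner ℝ n' n' = (1 : ℝ) := by rw [real_inner_self_eq_norm_sq, hn', one_pow]
  set x := (k * C) • a + (l * D) • a' with hx
  set y := (-(k * D)) • a + (l * C) • a' with hy
  set v := C • n + D • n' with hv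
  set v' := (-D) • n + C • n' with hv'
  have hxy : inner ℝ x y = 0 := by
    rw [hx, hy]
    simp only [inner_add_left, inner_add_right, real_inner_smul_left, real_inner_smul_right, haa,
      haa', real_inner_comm a a']
    linear_combination ht
  have hv1 : ‖v‖ = 1 := by
    rw [← pow_eq_one_iff_of_nonneg (norm_nonneg _) two_ne_zero, ← real_inner_self_eq_norm_sq, hv]
    simp only [inner_add_left, inner_add_right, real_inner_smul_left, real_inner_smul_right, hnn,
      hn'n', real_inner_comm n n', hnn']
    linear_combination hcs
  have hv'1 : ‖v'‖ = 1 := by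
    rw [← pow_eq_one_iff_of_nonneg (norm_nonneg _) two_ne_zero, ← real_inner_self_eq_norm_sq, hv']
    simp only [inner_add_left, inner_add_right, real_inner_smul_left, real_inner_smul_right, hnn,
      hn'n', real_inner_comm n n', hnn']
    linear_combination hcs
  have hvv' : inner ℝ v v' = 0 := by
    rw [hv, hv']
    simp only [inner_add_left, inner_add_right, real_inner_smul_left, real_inner_smul_right, hnn,
      hn'n', real_inner_comm n n', hnn']
    ring
  have hxy4 : ‖x‖ ^ 2 + ‖y‖ ^ 2 = 4 := by
    rw [← real_inner_self_eq_norm_sq, ← real_inner_self_eq_norm_sq, hx, hy]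
    simp only [inner_add_left, inner_add_right, real_inner_smul_left, real_inner_smul_right, haa,
      haa', real_inner_comm a a']
    linear_combination (k ^ 2 + l ^ 2) * hcs + hkl
  have hS : pauliDot a ⊗ₖ pauliDot (k • n) + pauliDot a' ⊗ₖ pauliDot (l • n') =
      pauliDot x ⊗ₖ pauliDot v + pauliDot y ⊗ₖ pauliDot v' := by
    have hcs' : (C : ℂ) ^ 2 + (D : ℂ) ^ 2 = 1 := by exact_mod_cast hcs
    rw [hx, hy, hv, hv']
    simp only [pauliDot_add, pauliDot_smul]
    ext i j
    simp only [Matrix.add_apply, kroneckerMap_apply, Matrix.smul_apply, smul_eq_mul]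
    push_cast
    linear_combination (-(k * pauliDot a i.1 j.1 * pauliDot n i.2 j.2) -
      l * pauliDot a' i.1 j.1 * pauliDot n' i.2 j.2) * hcs'
  rw [hS]
  obtain ⟨u, u', hu, hu', huu', hxu, hyu⟩ := exists_orthonormal_smul_eq hxy
  rw [hxu, hyu, pauliDot_smul, pauliDot_smul, smul_kronecker, smul_kronecker]
  have h2 : ∀ r : ℝ, (r : ℂ) = 2 * ((r / 2 : ℝ) : ℂ) := fun r => by push_cast; ring
  rcases le_total ‖y‖ ‖x‖ with hle | hle
  · obtain ⟨U, V, hUV⟩ := exists_localConj_eq_of_orthonormal hu hu' huu' hv1 hv'1 hvv' (‖x‖ / 2)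
      (‖y‖ / 2)
    refine ⟨U, V, ‖x‖ / 2, ‖y‖ / 2, by positivity, by linarith, by linarith, ?_⟩
    rw [hUV, ← h2, ← h2]
  · obtain ⟨U, V, hUV⟩ := exists_localConj_eq_of_orthonormal hu' hu
      (by rwa [real_inner_comm]) hv'1 hv1 (by rwa [real_inner_comm]) (‖y‖ / 2) (‖x‖ / 2)
    refine ⟨U, V, ‖y‖ / 2, ‖x‖ / 2, by positivity, by linarith, by linarith, ?_⟩
    rw [hUV, ← h2, ← h2, add_comm]

/-! ### States supported on `|00⟩` and `|11⟩` -/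

/-- The operator on the span of `|00⟩` and `|11⟩` with diagonal entries `(1 ± α) / 2` and
off-diagonal entries `c / 2`. -/
noncomputable def coreState (α c : ℝ) : Op :=
  single (0, 0) (0, 0) ((1 + α) / 2 : ℂ) + single (1, 1) (1, 1) ((1 - α) / 2 : ℂ) +
    single (0, 0) (1, 1) (c / 2 : ℂ) + single (1, 1) (0, 0) (c / 2 : ℂ)

theorem phiMixture_eq_coreState (p θ : ℝ) :
    phiMixture p θ = coreState ((2 * p - 1) * Real.cos (2 * θ)) (Real.sin (2 * θ)) := by
  have h1 : (Real.cos θ : ℂ) ^ 2 + (Real.sin θ : ℂ) ^ 2 = 1 := by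
    exact_mod_cast Real.cos_sq_add_sin_sq θ
  ext ⟨i, j⟩ ⟨k, l⟩
  rw [Real.cos_two_mul', Real.sin_two_mul]
  fin_cases i <;> fin_cases j <;> fin_cases k <;> fin_cases l <;>
    simp [phiMixture, coreState, ketbra, phi₁, phi₂, ket, vecMulVec_apply,
      -Complex.ofReal_cos, -Complex.ofReal_sin]
  · linear_combination (1 / 2 : ℂ) * h1
  · ring
  · ring
  · linear_combination (1 / 2 : ℂ) * h1

theorem isDensity_phiMixture {p : ℝ} (hp : p ∈ Set.Icc (0 : ℝ) 1) (θ : ℝ) :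
    IsDensity (phiMixture p θ) := by
  constructor
  · have h : ∀ r : ℝ, 0 ≤ r → ∀ v, ((r : ℂ) • ketbra v).PosSemidef := fun r hr v =>
      (posSemidef_vecMulVec_self_star v).smul (by exact_mod_cast hr)
    exact (h p hp.1 _).add (h (1 - p) (by linarith [hp.2]) _)
  · rw [phiMixture_eq_coreState]
    simp [coreState, trace, Fintype.sum_prod_type, Fin.sum_univ_two]
    ring

theorem exists_phiMixture_eq_coreState {α c : ℝ} (h : α ^ 2 + c ^ 2 ≤ 1) :
    ∃ p θ : ℝ, p ∈ Set.Icc (0 : ℝ) 1 ∧ θ ∈ Set.Ico (0 : ℝ) Real.pi ∧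
      coreState α c = phiMixture p θ := by
  have hc1 : -1 ≤ c := by nlinarith [sq_nonneg α]
  have hc2 : c ≤ 1 := by nlinarith [sq_nonneg α]
  set r := Real.sqrt (1 - c ^ 2) with hr
  have hr0 : 0 ≤ r := Real.sqrt_nonneg _
  have hr2 : r ^ 2 = 1 - c ^ 2 := Real.sq_sqrt (by nlinarith)
  obtain ⟨hα1, hα2⟩ : -r ≤ α ∧ α ≤ r := abs_le.mp (abs_le_of_sq_le_sq (by linarith) hr0)
  obtain ⟨p, hp, hpα⟩ : ∃ p ∈ Set.Icc (0 : ℝ) 1, (2 * p - 1) * r = α := by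
    rcases hr0.eq_or_lt with h0 | h0
    · exact ⟨0, by simp, by rw [← h0]; linarith⟩
    · refine ⟨(1 + α / r) / 2, ⟨?_, ?_⟩, by field_simp; ring⟩
      · have : -1 ≤ α / r := by rw [le_div_iff₀ h0]; linarith
        linarith
      · have : α / r ≤ 1 := by rw [div_le_one h0]; linarith
        linarith
  obtain ⟨θ, hθ, hcos, hsin⟩ : ∃ θ ∈ Set.Ico (0 : ℝ) Real.pi,
      Real.cos (2 * θ) = r ∧ Real.sin (2 * θ) = c := by
    have hpi := Real.pi_pos
    have h1 := Real.neg_pi_div_two_le_arcsin c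
    have h2 := Real.arcsin_le_pi_div_two c
    rcases le_or_gt 0 (Real.arcsin c) with h0 | h0
    · refine ⟨Real.arcsin c / 2, ⟨by linarith, by linarith⟩, ?_, ?_⟩
      · rw [mul_div_cancel₀ _ (two_ne_zero' ℝ), Real.cos_arcsin]
      · rw [mul_div_cancel₀ _ (two_ne_zero' ℝ), Real.sin_arcsin hc1 hc2]
    · refine ⟨Real.arcsin c / 2 + Real.pi, ⟨by linarith, by linarith⟩, ?_, ?_⟩
      · rw [mul_add, mul_div_cancel₀ _ (two_ne_zero' ℝ), Real.cos_add_two_pi, Real.cos_arcsin]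
      · rw [mul_add, mul_div_cancel₀ _ (two_ne_zero' ℝ), Real.sin_add_two_pi,
          Real.sin_arcsin hc1 hc2]
  exact ⟨p, θ, hp, hθ, by rw [phiMixture_eq_coreState, hcos, hsin, hpα]⟩

theorem isDensity_coreState_iff (α c : ℝ) : IsDensity (coreState α c) ↔ α ^ 2 + c ^ 2 ≤ 1 := by
  constructor
  · intro h
    have h1 := (h.1.submatrix ![((0 : Fin 2), (0 : Fin 2)), (1, 1)]).det_nonneg
    rw [det_fin_two] at h1
    simp [coreState] at h1
    have h2 : (((1 + α) / 2 * ((1 - α) / 2) - c / 2 * (c / 2) : ℝ) : ℂ) =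
        (1 + α) / 2 * ((1 - α) / 2) - c / 2 * (c / 2) := by push_cast; ring
    have h3 : (0 : ℝ) ≤ (1 + α) / 2 * ((1 - α) / 2) - c / 2 * (c / 2) := by
      rw [← Complex.zero_le_real, h2]
      exact sub_nonneg.mpr h1
    nlinarith
  · intro h
    obtain ⟨p, θ, hp, -, heq⟩ := exists_phiMixture_eq_coreState h
    exact heq ▸ isDensity_phiMixture hp θ

theorem mem_Q_iff {ρ : Op} : ρ ∈ Q ↔ ∃ (U V : unitaryGroup (Fin 2) ℂ) (α c : ℝ),
    α ^ 2 + c ^ 2 ≤ 1 ∧ ρ = localConj U V (coreState α c) := by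
  constructor
  · rintro ⟨U, V, p, θ, hp, -, rfl⟩
    refine ⟨U, V, _, _, ?_, by rw [phiMixture_eq_coreState]⟩
    rw [← isDensity_coreState_iff, ← phiMixture_eq_coreState]
    exact isDensity_phiMixture hp θ
  · rintro ⟨U, V, α, c, h, rfl⟩
    obtain ⟨p, θ, hp, hθ, heq⟩ := exists_phiMixture_eq_coreState h
    exact ⟨U, V, p, θ, hp, hθ, by rw [heq]⟩

theorem charpoly_of_corners (a b c d : ℂ) :
    (!![a, 0, 0, b; 0, 0, 0, 0; 0, 0, 0, 0; c, 0, 0, d] : Matrix (Fin 4) (Fin 4) ℂ).charpoly =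
      X ^ 2 * ((X - C a) * (X - C d) - C b * C c) := by
  have h : (!![a, 0, 0, b; 0, 0, 0, 0; 0, 0, 0, 0; c, 0, 0, d] :
      Matrix (Fin 4) (Fin 4) ℂ).charmatrix =
      !![X - C a, 0, 0, -C b; 0, X, 0, 0; 0, 0, X, 0; -C c, 0, 0, X - C d] := by
    ext i j
    fin_cases i <;> fin_cases j <;> simp
  rw [charpoly, h, det_succ_row_zero]
  simp [Fin.sum_univ_succ, det_fin_three, Fin.succAbove]
  ring

theorem spinFlip_coreState (α c : ℝ) : spinFlip (coreState α c) = coreState (-α) c := by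
  have h2 : (starRingEnd ℂ) 2 = 2 := map_ofNat _ 2
  ext ⟨i, j⟩ ⟨k, l⟩
  fin_cases i <;> fin_cases j <;> fin_cases k <;> fin_cases l <;>
    simp [spinFlip, coreState, mul_apply, Fintype.sum_prod_type, Fin.sum_univ_two, pauliY,
      sub_eq_add_neg, h2]

theorem submatrix_finProdFinEquiv_apply {R : Type*} (M : Matrix (Fin 4) (Fin 4) R)
    (i j k l : Fin 2) : M.submatrix finProdFinEquiv finProdFinEquiv (i, j) (k, l) =
      M (![![0, 1], ![2, 3]] i j) (![![0, 1], ![2, 3]] k l) := by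
  fin_cases i <;> fin_cases j <;> fin_cases k <;> fin_cases l <;> rfl

theorem charpoly_submatrix_finProdFinEquiv (M : Matrix (Fin 4) (Fin 4) ℂ) :
    (M.submatrix finProdFinEquiv finProdFinEquiv : Op).charpoly = M.charpoly :=
  charpoly_reindex (finProdFinEquiv (m := 2) (n := 2)).symm M

/-- The numbers `λₖ` of `coreState α c` are `(√(1 - α²) ± |c|) / 2`, `0` and `0`. -/
theorem concurrence_coreState {α c : ℝ} (h : α ^ 2 + c ^ 2 ≤ 1) :
    concurrence (coreState α c) = |c| := by
  set g := Real.sqrt (1 - α ^ 2) with hg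
  have hg2 : g ^ 2 = 1 - α ^ 2 := Real.sq_sqrt (by nlinarith [sq_nonneg c])
  have hgc : |c| ≤ g := abs_le_of_sq_le_sq (by linarith) (Real.sqrt_nonneg _)
  have hc := abs_nonneg c
  rw [concurrence_eq_of_charpoly ((isDensity_coreState_iff α c).mpr h).1
    (μ := ![(g + |c|) / 2, (g - |c|) / 2, 0, 0])]
  · simp only [Matrix.cons_val]
    rw [show (g + |c|) / 2 - (g - |c|) / 2 - 0 - 0 = |c| by ring, max_eq_right hc]
  · intro i j hij
    fin_cases i <;> fin_cases j <;> simp at hij ⊢ <;> linarith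
  · intro i
    fin_cases i <;> simp <;> linarith
  · have hmat : coreState α c * spinFlip (coreState α c) =
        (!![((1 - α ^ 2 + c ^ 2) / 4 : ℂ), 0, 0, (1 + α) * c / 2; 0, 0, 0, 0; 0, 0, 0, 0;
          (1 - α) * c / 2, 0, 0, (1 - α ^ 2 + c ^ 2) / 4] : Matrix (Fin 4) (Fin 4) ℂ).submatrix
            finProdFinEquiv finProdFinEquiv := by
      rw [spinFlip_coreState]
      ext ⟨i, j⟩ ⟨k, l⟩
      rw [submatrix_finProdFinEquiv_apply]
      simp only [mul_apply, Fintype.sum_prod_type, Fin.sum_univ_two]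
      fin_cases i <;> fin_cases j <;> fin_cases k <;> fin_cases l <;> simp [coreState] <;> ring
    have hcc : ((|c| : ℝ) : ℂ) ^ 2 = (c : ℂ) ^ 2 := by exact_mod_cast sq_abs c
    have hgg : (g : ℂ) ^ 2 = 1 - (α : ℂ) ^ 2 := by exact_mod_cast hg2
    have h1 : ((1 - α ^ 2 + c ^ 2) / 4 : ℂ) + (1 - α ^ 2 + c ^ 2) / 4 =
        ((g + (|c| : ℝ)) / 2) ^ 2 + ((g - (|c| : ℝ)) / 2) ^ 2 := by
      linear_combination -(1 / 2 : ℂ) * hcc - (1 / 2 : ℂ) * hgg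
    have h2 : ((1 - α ^ 2 + c ^ 2) / 4 : ℂ) * ((1 - α ^ 2 + c ^ 2) / 4) -
        (1 + α) * c / 2 * ((1 - α) * c / 2) =
          ((g + (|c| : ℝ)) / 2) ^ 2 * ((g - (|c| : ℝ)) / 2) ^ 2 := by
      have h3 : ((g + (|c| : ℝ)) / 2 : ℂ) ^ 2 * ((g - (|c| : ℝ)) / 2) ^ 2 =
          (((g : ℂ) ^ 2 - ((|c| : ℝ) : ℂ) ^ 2) / 4) ^ 2 := by ring
      rw [h3, hcc, hgg]
      ring
    have h1' := congrArg (C : ℂ → ℂ[X]) h1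
    have h2' := congrArg (C : ℂ → ℂ[X]) h2
    rw [C_add, C_add] at h1'
    rw [C_sub, C_mul, C_mul, C_mul] at h2'
    rw [hmat, charpoly_submatrix_finProdFinEquiv, charpoly_of_corners, Fin.prod_univ_four]
    simp only [Matrix.cons_val, Complex.ofReal_zero, Complex.ofReal_div, Complex.ofReal_add,
      Complex.ofReal_sub, Complex.ofReal_ofNat, ne_eq, OfNat.ofNat_ne_zero, not_false_eq_true,
      zero_pow, C_0, sub_zero]
    linear_combination -(X ^ 3) * h1' + X ^ 2 * h2'

theorem pauliX_mem_unitaryGroup : pauliX ∈ unitaryGroup (Fin 2) ℂ := by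
  obtain ⟨h1, -, h3⟩ := (isObservable_iff _).mp isObservable_pauliX
  rw [mem_unitaryGroup_iff, star_eq_conjTranspose, h1, h3]

theorem pauliZ_mem_unitaryGroup : pauliZ ∈ unitaryGroup (Fin 2) ℂ := by
  obtain ⟨h1, -, h3⟩ := (isObservable_iff _).mp isObservable_pauliZ
  rw [mem_unitaryGroup_iff, star_eq_conjTranspose, h1, h3]

theorem localConj_apply (U V : unitaryGroup (Fin 2) ℂ) (ρ : Op) (i j k l : Fin 2) :
    localConj U V ρ (i, j) (k, l) = ∑ a, ∑ b, ∑ c, ∑ d, (U : QubitOp) i c * (V : QubitOp) j d *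
      ρ (c, d) (a, b) * (star ((U : QubitOp) k a) * star ((V : QubitOp) l b)) := by
  simp [localConj, mul_apply, Fintype.sum_prod_type, kroneckerMap_apply]
  ring

theorem vwMatrix_eq_localConj (α c : ℝ) :
    vwMatrix α c = localConj ⟨pauliX, pauliX_mem_unitaryGroup⟩ 1 (coreState α c) := by
  ext ⟨i, j⟩ ⟨k, l⟩
  rw [vwMatrix, submatrix_finProdFinEquiv_apply, localConj_apply]
  simp only [Fin.sum_univ_two]
  fin_cases i <;> fin_cases j <;> fin_cases k <;> fin_cases l <;>
    simp [coreState, pauliX] <;> ring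

theorem localConj_pauliZ_coreState (α c : ℝ) :
    localConj ⟨pauliZ, pauliZ_mem_unitaryGroup⟩ 1 (coreState α c) = coreState α (-c) := by
  ext ⟨i, j⟩ ⟨k, l⟩
  rw [localConj_apply]
  simp only [Fin.sum_univ_two]
  fin_cases i <;> fin_cases j <;> fin_cases k <;> fin_cases l <;>
    simp [coreState, pauliZ, neg_div]

theorem isDensity_localConj_iff (U V : unitaryGroup (Fin 2) ℂ) (ρ : Op) :
    IsDensity (localConj U V ρ) ↔ IsDensity ρ :=
  ⟨fun h => localConj_inv_localConj U V ρ ▸ h.localConj U⁻¹ V⁻¹, fun h => h.localConj U V⟩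

/-- Both sets consist of the local conjugates of the states `coreState α c`; for Verstraete–Wolf
states, the condition on the concurrence says `c ≥ 0`, and conjugation by `Z` on one side reverses
the sign of `c`. -/
theorem Q_eq_vwClass : Q = vwClass := by
  ext ρ
  rw [mem_Q_iff]
  constructor
  · have key : ∀ (U V : unitaryGroup (Fin 2) ℂ) (α c : ℝ), 0 ≤ c → α ^ 2 + c ^ 2 ≤ 1 →
        localConj U V (coreState α c) ∈ vwClass := by
      intro U V α c hc h
      have hd := (isDensity_coreState_iff α c).mpr h
      refine ⟨U * ⟨pauliX, pauliX_mem_unitaryGroup⟩⁻¹, V, α, c, ?_, ?_, ?_⟩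
      · rwa [vwMatrix_eq_localConj, isDensity_localConj_iff]
      · rw [vwMatrix_eq_localConj, concurrence_localConj hd.1, concurrence_coreState h,
          abs_of_nonneg hc]
      · rw [vwMatrix_eq_localConj, localConj_localConj, inv_mul_cancel_right, mul_one]
    rintro ⟨U, V, α, c, h, rfl⟩
    rcases le_total 0 c with hc | hc
    · exact key U V α c hc h
    · have := key (U * ⟨pauliZ, pauliZ_mem_unitaryGroup⟩) V α (-c) (by linarith) (by simpa using h)
      rwa [← mul_one V, ← localConj_localConj, localConj_pauliZ_coreState, neg_neg] at this
  · rintro ⟨U, V, α, c, hd, -, rfl⟩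
    rw [vwMatrix_eq_localConj, isDensity_localConj_iff, isDensity_coreState_iff] at hd
    exact ⟨_, _, α, c, hd, by rw [vwMatrix_eq_localConj, localConj_localConj]⟩

/-! ### The CHSH bound -/

theorem trace_mul_localConj (U V : unitaryGroup (Fin 2) ℂ) (ρ S : Op) :
    (ρ * localConj U V S).trace = (localConj U⁻¹ V⁻¹ ρ * S).trace := by
  rw [← trace_localConj U V (localConj U⁻¹ V⁻¹ ρ * S), ← localConj_mul, localConj_localConj_inv]

theorem trace_mul_chshNormalForm (ρ : Op) (c s : ℝ) :
    (ρ * chshNormalForm c s).trace.re =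
      2 * c * ((ρ (0, 0) (0, 0)).re + (ρ (1, 1) (1, 1)).re - (ρ (0, 1) (0, 1)).re -
        (ρ (1, 0) (1, 0)).re) +
      2 * s * ((ρ (0, 0) (1, 1)).re + (ρ (1, 1) (0, 0)).re + (ρ (0, 1) (1, 0)).re +
        (ρ (1, 0) (0, 1)).re) := by
  have h : (ρ * chshNormalForm c s).trace =
      ((2 * c : ℝ) : ℂ) * (ρ (0, 0) (0, 0) + ρ (1, 1) (1, 1) - ρ (0, 1) (0, 1) - ρ (1, 0) (1, 0)) +
      ((2 * s : ℝ) : ℂ) * (ρ (0, 0) (1, 1) + ρ (1, 1) (0, 0) + ρ (0, 1) (1, 0) +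
        ρ (1, 0) (0, 1)) := by
    simp [trace, chshNormalForm, mul_apply, Fintype.sum_prod_type, Fin.sum_univ_two, pauliX,
      pauliZ]
    ring
  rw [h, Complex.add_re, Complex.re_ofReal_mul, Complex.re_ofReal_mul]
  simp only [Complex.add_re, Complex.sub_re]

theorem re_diag_nonneg {ρ : Op} (hρ : ρ.PosSemidef) (i : Fin 2 × Fin 2) :
    0 ≤ (ρ i i).re :=
  (Complex.nonneg_iff.mp hρ.diag_nonneg).1

theorem re_apply_comm {ρ : Op} (hρ : ρ.PosSemidef) (i j : Fin 2 × Fin 2) :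
    (ρ i j).re = (ρ j i).re := by
  rw [← hρ.isHermitian.apply i j, Complex.star_def, Complex.conj_re]

/-- Off-diagonal entries of a positive operator are dominated by the diagonal: the vector
`eᵢ - eⱼ` has nonnegative expectation. -/
theorem two_mul_re_apply_le {ρ : Op} (hρ : ρ.PosSemidef) (i j : Fin 2 × Fin 2) :
    2 * (ρ i j).re ≤ (ρ i i).re + (ρ j j).re := by
  have h := hρ.dotProduct_mulVec_nonneg (Pi.single i 1 - Pi.single j 1)
  have h' := (Complex.nonneg_iff.mp h).1
  simp only [star_sub, ← Pi.single_star, star_one, mulVec_sub, mulVec_single_one, sub_dotProduct,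
    dotProduct_sub, single_one_dotProduct, col_apply, Complex.sub_re] at h'
  have := re_apply_comm hρ i j
  linarith

theorem IsDensity.re_diag_sum {ρ : Op} (hρ : IsDensity ρ) :
    (ρ (0, 0) (0, 0)).re + (ρ (1, 1) (1, 1)).re + (ρ (0, 1) (0, 1)).re + (ρ (1, 0) (1, 0)).re =
      1 := by
  have h := congrArg Complex.re hρ.2
  simp [trace, Fintype.sum_prod_type, Fin.sum_univ_two] at h
  linarith

theorem add_mul_le_sqrt {c s C : ℝ} (h : c ^ 2 + s ^ 2 = 1) :
    c + s * C ≤ Real.sqrt (1 + C ^ 2) := by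
  refine Real.le_sqrt_of_sq_le ?_
  have : (c + s * C) ^ 2 + (c * C - s) ^ 2 = (c ^ 2 + s ^ 2) * (1 + C ^ 2) := by ring
  rw [h, one_mul] at this
  linarith [sq_nonneg (c * C - s)]

/-- The value of `2 c Z ⊗ Z + 2 s X ⊗ X`, estimated in terms of the weight outside the
span of `|00⟩` and `|11⟩`. The factor of `2 s` is the expectation that `fidelity_le_concurrence`
bounds. -/
theorem trace_mul_chshNormalForm_le {ρ : Op} (hρ : IsDensity ρ) {c s : ℝ} (hs : 0 ≤ s) :
    (ρ * chshNormalForm c s).trace.re ≤ 2 * c +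
      2 * s * (2 * (ρ (0, 0) (1, 1)).re - (ρ (0, 1) (0, 1)).re - (ρ (1, 0) (1, 0)).re) -
      4 * (c - s) * ((ρ (0, 1) (0, 1)).re + (ρ (1, 0) (1, 0)).re) := by
  have h1 := two_mul_re_apply_le hρ.1 (0, 1) (1, 0)
  have h2 := re_apply_comm hρ.1 (0, 0) (1, 1)
  have h3 := re_apply_comm hρ.1 (0, 1) (1, 0)
  have h4 := hρ.re_diag_sum
  have h5 := mul_le_mul_of_nonneg_left h1 hs
  have h6 : c * _ = c * _ := congrArg (c * ·) h4
  rw [trace_mul_chshNormalForm, ← h2, ← h3]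
  linarith

theorem chsh_value_le {ρ S : Op} (hρ : IsDensity ρ) (hS : IsCHSHOperator S) :
    (ρ * S).trace.re ≤ 2 * Real.sqrt (1 + concurrence ρ ^ 2) := by
  obtain ⟨U, V, c, s, hs, hsc, h1, rfl⟩ := hS.exists_normalForm
  have hω := hρ.localConj U⁻¹ V⁻¹
  rw [trace_mul_localConj, ← concurrence_localConj hρ.1 U⁻¹ V⁻¹]
  set ω := localConj U⁻¹ V⁻¹ ρ
  have h2 := trace_mul_chshNormalForm_le hω (c := c) hs
  have h3 := fidelity_le_concurrence hω.1
  have h4 := add_mul_le_sqrt (C := concurrence ω) h1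
  have h5 := re_diag_nonneg hω.1 (0, 1)
  have h6 := re_diag_nonneg hω.1 (1, 0)
  have h7 := mul_le_mul_of_nonneg_left h3 hs
  have h8 := mul_nonneg (sub_nonneg.mpr hsc) (add_nonneg h5 h6)
  linarith

/-- If the bound is attained by `2 c Z ⊗ Z + 2 s X ⊗ X`, then the state has no weight outside the
span of `|00⟩` and `|11⟩`. -/
theorem diag_eq_zero_of_eq {ω : Op} (hω : IsDensity ω) {c s : ℝ} (hs : 0 ≤ s) (hsc : s ≤ c)
    (h1 : c ^ 2 + s ^ 2 = 1)
    (h : (ω * chshNormalForm c s).trace.re = 2 * Real.sqrt (1 + concurrence ω ^ 2)) :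
    (ω (0, 1) (0, 1)).re = 0 ∧ (ω (1, 0) (1, 0)).re = 0 := by
  have h2 := trace_mul_chshNormalForm_le hω (c := c) hs
  have h3 := fidelity_le_concurrence hω.1
  have h4 := add_mul_le_sqrt (C := concurrence ω) h1
  have h5 := re_diag_nonneg hω.1 (0, 1)
  have h6 := re_diag_nonneg hω.1 (1, 0)
  have h7 := mul_le_mul_of_nonneg_left h3 hs
  have h8 := mul_nonneg (sub_nonneg.mpr hsc) (add_nonneg h5 h6)
  have h9 := two_mul_re_apply_le hω.1 (0, 0) (1, 1)
  have h10 := hω.re_diag_sum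
  set C := concurrence ω
  set m := (ω (0, 1) (0, 1)).re + (ω (1, 0) (1, 0)).re with hm
  suffices hm0 : m = 0 by constructor <;> linarith
  rcases hsc.lt_or_eq with hlt | rfl
  · have : (c - s) * m = 0 := by linarith
    exact (mul_eq_zero.mp this).resolve_left (sub_pos.mpr hlt).ne'
  · -- equality of the weights forces concurrence one, hence a maximally entangled state
    have hs0 : 0 < s := by nlinarith
    have hC : s + s * C = Real.sqrt (1 + C ^ 2) := by linarith
    have hC2 : (s + s * C) ^ 2 = 1 + C ^ 2 := by
      rw [hC]; exact Real.sq_sqrt (by positivity)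
    have hC1 : C = 1 := by nlinarith [sq_nonneg (C - 1)]
    have hF : s * (2 * (ω (0, 0) (1, 1)).re - (ω (0, 1) (0, 1)).re - (ω (1, 0) (1, 0)).re) =
        s * C := by linarith
    have := mul_left_cancel₀ hs0.ne' hF
    linarith

/-- A state without weight outside the span of `|00⟩` and `|11⟩` lies in `Q`; a diagonal unitary
makes its off-diagonal entry real. -/
theorem mem_Q_of_diag_eq_zero {ω : Op} (hω : IsDensity ω) (h01 : (ω (0, 1) (0, 1)).re = 0)
    (h10 : (ω (1, 0) (1, 0)).re = 0) : ω ∈ Q := by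
  have hherm := hω.1.isHermitian
  have hre : ∀ i, ω i i = (ω i i).re := fun i =>
    (Complex.conj_eq_iff_re.mp (hherm.apply i i)).symm
  have hcol : ∀ i, (ω i i).re = 0 → ∀ j, ω j i = 0 := by
    intro i hi j
    have h : star (Pi.single i (1 : ℂ)) ⬝ᵥ (ω *ᵥ Pi.single i 1) = 0 := by
      rw [← Pi.single_star, star_one, mulVec_single_one, single_one_dotProduct, col_apply, hre i,
        hi, Complex.ofReal_zero]
    have := congrFun ((hω.1.dotProduct_mulVec_zero_iff _).mp h) j
    rwa [mulVec_single_one] at this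
  have hrow : ∀ i, (ω i i).re = 0 → ∀ j, ω i j = 0 := by
    intro i hi j
    rw [← hherm.apply i j, hcol i hi j, star_zero]
  set w := ω (0, 0) (1, 1) with hw
  have hw' : ω (1, 1) (0, 0) = star w := (hherm.apply (1, 1) (0, 0)).symm
  set β : ℂ := Complex.exp (-(w.arg) * Complex.I) with hβ
  have hββ : β * star β = 1 := by
    rw [Complex.star_def, Complex.mul_conj, Complex.normSq_eq_norm_sq, hβ, ← Complex.ofReal_neg,
      Complex.norm_exp_ofReal_mul_I]
    simp
  have hwβ : w = ‖w‖ * star β := by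
    rw [hβ, Complex.star_def, ← Complex.exp_conj]
    simp [Complex.norm_mul_exp_arg_mul_I]
  have hG : (diagonal ![1, β] : QubitOp) ∈ unitaryGroup (Fin 2) ℂ := by
    rw [mem_unitaryGroup_iff, star_eq_conjTranspose, diagonal_conjTranspose, diagonal_mul_diagonal,
      ← diagonal_one]
    congr 1
    ext i
    fin_cases i
    · simp
    · simpa using hββ
  have hsum := hω.re_diag_sum
  have h11 : (ω (1, 1) (1, 1)).re = 1 - (ω (0, 0) (0, 0)).re := by linarith
  have hββ' : β * (starRingEnd ℂ) β = 1 := hββ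
  have heq : ω = localConj 1 ⟨_, hG⟩ (coreState (2 * (ω (0, 0) (0, 0)).re - 1) (2 * ‖w‖)) := by
    have hws : (starRingEnd ℂ) w = β * ‖w‖ := by
      conv_lhs => rw [hwβ]
      simp [mul_comm]
    have hwβ' : w = ‖w‖ * (starRingEnd ℂ) β := hwβ
    ext ⟨i, j⟩ ⟨k, l⟩
    rw [localConj_apply]
    simp only [Fin.sum_univ_two]
    fin_cases i <;> fin_cases j <;> fin_cases k <;> fin_cases l <;>
      simp [coreState, hcol _ h01, hcol _ h10, hrow _ h01, hrow _ h10, hw', ← hw, hws]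
    · exact hre _
    · exact hwβ'
    · rw [hre, h11]
      push_cast
      linear_combination (-1 + ((ω (0, 0) (0, 0)).re : ℂ)) * hββ'
  have hcore := hω
  rw [heq, isDensity_localConj_iff, isDensity_coreState_iff] at hcore
  exact mem_Q_iff.mpr ⟨_, _, _, _, hcore, heq⟩

theorem mem_Q_of_chsh_value_eq {ρ S : Op} (hρ : IsDensity ρ) (hS : IsCHSHOperator S)
    (h : (ρ * S).trace.re = 2 * Real.sqrt (1 + concurrence ρ ^ 2)) : ρ ∈ Q := by
  obtain ⟨U, V, c, s, hs, hsc, h1, rfl⟩ := hS.exists_normalForm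
  have hω := hρ.localConj U⁻¹ V⁻¹
  rw [trace_mul_localConj, ← concurrence_localConj hρ.1 U⁻¹ V⁻¹] at h
  obtain ⟨h01, h10⟩ := diag_eq_zero_of_eq hω hs hsc h1 h
  obtain ⟨U', V', α, c', hc', heq⟩ := mem_Q_iff.mp (mem_Q_of_diag_eq_zero hω h01 h10)
  refine mem_Q_iff.mpr ⟨U * U', V * V', α, c', hc', ?_⟩
  rw [← localConj_localConj, ← heq, localConj_localConj_inv]

theorem isCHSHOperator_chshNormalForm {c s : ℝ} (h : c ^ 2 + s ^ 2 = 1) :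
    IsCHSHOperator (chshNormalForm c s) := by
  have hB : ∀ s' : ℝ, c ^ 2 + s' ^ 2 = 1 →
      IsObservable ((c : ℂ) • pauliZ + (s' : ℂ) • pauliX) := by
    intro s' h'
    refine ⟨!₂[s', 0, c], ?_, ?_⟩
    · rw [EuclideanSpace.norm_eq, Fin.sum_univ_three]
      simp
      linarith
    · simp [pauliDot, add_comm]
  refine ⟨pauliZ, pauliX, _, _, isObservable_pauliZ, isObservable_pauliX, hB s h,
    hB (-s) (by simpa using h), ?_⟩
  ext i j
  simp [chshNormalForm, kroneckerMap_apply]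
  ring

/-- On `coreState α c`, the observables `Z ⊗ Z` and `X ⊗ X` have expectations `1` and `c`, and the
optimal weights for them are proportional to `1` and `c`. -/
theorem exists_chsh_value_eq {ρ : Op} (hρ : ρ ∈ Q) :
    ∃ S, IsCHSHOperator S ∧ (ρ * S).trace.re = 2 * Real.sqrt (1 + concurrence ρ ^ 2) := by
  obtain ⟨U, V, α, c, h, rfl⟩ := mem_Q_iff.mp hρ
  have hd := (isDensity_coreState_iff α c).mpr h
  set r := Real.sqrt (1 + c ^ 2) with hr
  have hr2 : r ^ 2 = 1 + c ^ 2 := Real.sq_sqrt (by positivity)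
  have hr0 : r ≠ 0 := (Real.sqrt_pos.mpr (by positivity)).ne'
  refine ⟨localConj U V (chshNormalForm (1 / r) (c / r)),
    (isCHSHOperator_chshNormalForm ?_).localConj U V, ?_⟩
  · field_simp
    linarith
  · rw [localConj_mul, trace_localConj, concurrence_localConj hd.1, concurrence_coreState h,
      sq_abs, ← hr, trace_mul_chshNormalForm]
    have h0 : ((1 + (α : ℂ)) / 2).re = (1 + α) / 2 := by
      rw [show (1 + (α : ℂ)) / 2 = (((1 + α) / 2 : ℝ) : ℂ) by push_cast; ring, Complex.ofReal_re]
    have h1 : ((1 - (α : ℂ)) / 2).re = (1 - α) / 2 := by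
      rw [show (1 - (α : ℂ)) / 2 = (((1 - α) / 2 : ℝ) : ℂ) by push_cast; ring, Complex.ofReal_re]
    have h2 : ((c : ℂ) / 2).re = c / 2 := by
      rw [show (c : ℂ) / 2 = ((c / 2 : ℝ) : ℂ) by push_cast; ring, Complex.ofReal_re]
    simp [coreState, h0, h1, h2, -Complex.div_ofNat_re]
    field_simp
    linarith

/-- The set of CHSH values is a continuous image of a product of four spheres, hence compact. -/
theorem isGreatest_nonlocality (ρ : Op) : IsGreatest (chshValues ρ) (nonlocality ρ) := by
  let f : EuclideanSpace ℝ (Fin 3) × EuclideanSpace ℝ (Fin 3) × EuclideanSpace ℝ (Fin 3) ×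
      EuclideanSpace ℝ (Fin 3) → ℝ := fun x =>
    (ρ * (pauliDot x.1 ⊗ₖ (pauliDot x.2.2.1 + pauliDot x.2.2.2) +
      pauliDot x.2.1 ⊗ₖ (pauliDot x.2.2.1 - pauliDot x.2.2.2))).trace.re
  have hpd : Continuous pauliDot := by
    unfold pauliDot
    fun_prop
  have hf : Continuous f := by
    have hk : ∀ i j, Continuous fun x : EuclideanSpace ℝ (Fin 3) => pauliDot x i j :=
      fun i j => (continuous_apply_apply i j).comp hpd
    simp only [f, trace, diag_apply, mul_apply, Matrix.add_apply, Matrix.sub_apply,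
      kroneckerMap_apply]
    fun_prop
  let K : Set (EuclideanSpace ℝ (Fin 3)) := Metric.sphere 0 1
  have hK : IsCompact K := isCompact_sphere 0 1
  have himg : chshValues ρ = f '' (K ×ˢ K ×ˢ K ×ˢ K) := by
    ext x
    constructor
    · rintro ⟨_, ⟨_, _, _, _, ⟨a, ha, rfl⟩, ⟨a', ha', rfl⟩, ⟨b, hb, rfl⟩, ⟨b', hb', rfl⟩, rfl⟩, rfl⟩
      exact ⟨(a, a', b, b'), ⟨by simpa [K], by simpa [K], by simpa [K], by simpa [K]⟩, rfl⟩
    · rintro ⟨⟨a, a', b, b'⟩, ⟨ha, ha', hb, hb'⟩, rfl⟩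
      exact ⟨_, ⟨_, _, _, _, ⟨a, by simpa [K] using ha, rfl⟩, ⟨a', by simpa [K] using ha', rfl⟩,
        ⟨b, by simpa [K] using hb, rfl⟩, ⟨b', by simpa [K] using hb', rfl⟩, rfl⟩, rfl⟩
  have hcomp : IsCompact (chshValues ρ) :=
    himg ▸ (hK.prod (hK.prod (hK.prod hK))).image hf
  exact hcomp.isGreatest_sSup
    ⟨_, _, isCHSHOperator_chshNormalForm (c := 1) (s := 0) (by norm_num), rfl⟩

end TwoQubit


theorem mainTheorem1 :
    (∀ ρ : TwoQubit.Op, TwoQubit.IsDensity ρ →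
      IsGreatest (TwoQubit.chshValues ρ) (TwoQubit.nonlocality ρ) ∧
      TwoQubit.nonlocality ρ ≤ 2 * Real.sqrt (1 + TwoQubit.concurrence ρ ^ 2) ∧
      (TwoQubit.nonlocality ρ = 2 * Real.sqrt (1 + TwoQubit.concurrence ρ ^ 2) ↔
        ρ ∈ TwoQubit.Q)) ∧
    TwoQubit.Q = TwoQubit.vwClass := by
  refine ⟨fun ρ hρ => ?_, TwoQubit.Q_eq_vwClass⟩
  have hmax := TwoQubit.isGreatest_nonlocality ρ
  obtain ⟨S, hS, hval⟩ := hmax.1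
  have hle : TwoQubit.nonlocality ρ ≤ 2 * Real.sqrt (1 + TwoQubit.concurrence ρ ^ 2) :=
    hval ▸ TwoQubit.chsh_value_le hρ hS
  refine ⟨hmax, hle, fun h => TwoQubit.mem_Q_of_chsh_value_eq hρ hS (hval ▸ h), fun h => ?_⟩
  obtain ⟨S', hS', hval'⟩ := TwoQubit.exists_chsh_value_eq h
  exact le_antisymm hle (hmax.2 ⟨S', hS', hval'.symm⟩)
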